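/- Let $K$ be a field, $S=K[x_1,\dots,x_n]$ with its $\mathbb N^n$-grading, and $[n]=\{1,\dots,n\}$; subsets of $[n]$ are identified with vectors in $\{0,1\}^n$. A finitely generated $\mathbb N^n$-graded $S$-module $M$ is \emph{squarefree} if multiplication by $x_i$ is a bijection $M_a\to M_{a+\epsilon_i}$ for all $a\in\mathbb N^n$ and all $i\in\operatorname{supp}(a)$. A squarefree submodule of $M$ is a graded submodule which is itself squarefree. For $F\subseteq[n]$ let $P_F=(x_i : i\in F)$, and let $S/P_F(-G)$ be $S/P_F$ with its generator placed in degree $G$. Let $E=K\langle e_1,\dots,e_n\rangle$ be the exterior algebra, with its $\mathbb N^n$-grading, and let $\sigma(A,\{j\})=\#\{r\in A: r>j\}$. Graded $E$-modules are bimodules with $fm=(-1)^{|\deg f||\deg m|}mf$. For a squarefree $S$-module $M$ let $\mathbf F(M)=\bigoplus_{A\subseteq[n]}M_A$, the graded $E$-module with $w\cdot e_j=(-1)^{\sigma(A,\{j\})}x_jw$ if $w\in M_A$, $j\notin A$, and $w\cdot e_j=0$ if $j\in A$. For a graded $E$-module $N$ concentrated in squarefree degrees let $\mathbf G(N)=\bigoplus_{a\in\mathbb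 N^n}N_{\operatorname{supp}(a)}$, the $S$-module on which $x_j$ maps the component of degree $a$ to that of degree $a+\epsilon_j$, by the identity of $N_{\operatorname{supp}(a)}$ if $j\in\operatorname{supp}(a)$ and by $y\mapsto(-1)^{\sigma(\operatorname{supp}(a),\{j\})}\,y\,e_j$ otherwise. The \emph{Alexander dual} of $M$ is $M^\vee=\mathbf G(\operatorname{Hom}_E(\mathbf F(M),E))$. \textbf{Theorem.} Let $M$ be a squarefree $S$-module, let $r\ge 0$ and let $F_1,\dots,F_r,G_1,\dots,G_r\subseteq[n]$. Then there is a chain $0=M_0\subseteq M_1\subseteq\cdots\subseteq M_r=M$ of squarefree submodules of $M$ with graded isomorphisms $M_i/M_{i-1}\cong S/P_{F_i}(-G_i)$ for $i=1,\dots,r$ if and only if there is a chain $0=L_0\subseteq L_1\subseteq\cdots\subseteq L_r=M^\vee$ of squarefree submodules of $M^\vee$ with graded isomorphisms $L_i/L_{i-1}\cong S/P_{G_{r+1-i}}(-F_{r+1-i})$ for $i=1,\dots,r$. That is, prime filtrations dualize with the roles of $F$ and $G$ swapped and the order of the quotients reversed. -/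

import Mathlib

namespace SqfreeDual

universe u v

noncomputable section

/-! ## Multigraded and squarefree modules over `S = K[x_1, …, x_n]` -/

/-- The exponent vector in `{0,1}^n` with support `F`. -/
def ind {n : ℕ} (F : Finset (Fin n)) : Fin n →₀ ℕ :=
  ∑ j ∈ F, Finsupp.single j 1

/-- `M = ⨁ 𝓜 a` is an `ℕ^n`-graded module over the polynomial ring. As the monomials are
products of variables, `S_a M_b ⊆ M_{a+b}` amounts to `x_i M_a ⊆ M_{a+ε_i}`. -/
class IsMultigraded {K : Type u} [Field K] {n : ℕ} {M : Type v} [AddCommGroup M] [Module K M]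
    [Module (MvPolynomial (Fin n) K) M] (𝓜 : (Fin n →₀ ℕ) → Submodule K M) : Prop where
  isInternal : DirectSum.IsInternal 𝓜
  X_smul_mem : ∀ (i : Fin n) (a : Fin n →₀ ℕ), ∀ m ∈ 𝓜 a,
    (MvPolynomial.X i : MvPolynomial (Fin n) K) • m ∈ 𝓜 (a + Finsupp.single i 1)

/-- Squarefree modules: finitely generated `ℕ^n`-graded modules such that multiplication
`x_i : M_a → M_{a+ε_i}` is bijective whenever `i ∈ supp a`. -/
class IsSquarefreeModule {K : Type u} [Field K] {n : ℕ} {M : Type v} [AddCommGroup M]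
    [Module K M] [Module (MvPolynomial (Fin n) K) M] (𝓜 : (Fin n →₀ ℕ) → Submodule K M) : Prop
    extends IsMultigraded 𝓜 where
  finite : Module.Finite (MvPolynomial (Fin n) K) M
  bijOn : ∀ (a : Fin n →₀ ℕ), ∀ i ∈ a.support,
    Set.BijOn (fun m : M => (MvPolynomial.X i : MvPolynomial (Fin n) K) • m)
      (𝓜 a) (𝓜 (a + Finsupp.single i 1))

section Chains

variable {K : Type u} [Field K] {n : ℕ} {M : Type v} [AddCommGroup M] [Module K M]
  [Module (MvPolynomial (Fin n) K) M] [IsScalarTower K (MvPolynomial (Fin n) K) M]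

/-- The grading `L_a = L ∩ M_a` of a submodule `L` of `M`. -/
def submoduleGrading (𝓜 : (Fin n →₀ ℕ) → Submodule K M)
    (L : Submodule (MvPolynomial (Fin n) K) M) (a : Fin n →₀ ℕ) : Submodule K L :=
  (𝓜 a).comap (L.subtype.restrictScalars K)

/-- The grading of a quotient `M ⧸ L`: the images of the components of `M`. -/
def quotientGrading (𝓜 : (Fin n →₀ ℕ) → Submodule K M)
    (L : Submodule (MvPolynomial (Fin n) K) M) (a : Fin n →₀ ℕ) : Submodule K (M ⧸ L) :=
  (𝓜 a).map (L.mkQ.restrictScalars K)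

/-- `L` is a squarefree submodule of `M`: with the grading `L_a = L ∩ M_a` it is
a squarefree module (in particular it is the direct sum of these components). -/
def IsSquarefreeSubmodule (𝓜 : (Fin n →₀ ℕ) → Submodule K M)
    (L : Submodule (MvPolynomial (Fin n) K) M) : Prop :=
  IsSquarefreeModule (submoduleGrading 𝓜 L)

/-- An isomorphism of graded modules: an `S`-linear isomorphism respecting degrees. -/
def GradedIso {A B : Type*} [AddCommGroup A] [Module K A] [Module (MvPolynomial (Fin n) K) A]
    [AddCommGroup B] [Module K B] [Module (MvPolynomial (Fin n) K) B]
    (𝓐 : (Fin n →₀ ℕ) → Submodule K A) (𝓑 : (Fin n →₀ ℕ) → Submodule K B) : Prop :=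
  ∃ f : A ≃ₗ[MvPolynomial (Fin n) K] B, ∀ a x, x ∈ 𝓐 a ↔ f x ∈ 𝓑 a

/-- The monomial prime ideal `P_F = (x_i : i ∈ F)`. -/
def primeIdeal (K : Type u) [Field K] {n : ℕ} (F : Finset (Fin n)) :
    Ideal (MvPolynomial (Fin n) K) :=
  Ideal.span (MvPolynomial.X '' (F : Set (Fin n)))

/-- The grading of `(S/P_F)(-G)`, the module `S/P_F` with its generator placed in degree `G`:
the component of degree `a` is spanned by the class of `x^b` with `b + G = a`
(and is zero if there is no such `b`). -/
def primeQuotientGrading (K : Type u) [Field K] {n : ℕ} (F G : Finset (Fin n))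
    (a : Fin n →₀ ℕ) : Submodule K (MvPolynomial (Fin n) K ⧸ primeIdeal K F) :=
  Submodule.span K {q | ∃ b : Fin n →₀ ℕ, b + ind G = a ∧
    q = Ideal.Quotient.mk (primeIdeal K F) (MvPolynomial.monomial b 1)}

/-- There is a chain `0 = M_0 ⊆ M_1 ⊆ ⋯ ⊆ M_r = M` of squarefree submodules of `M` with
`M_{i+1} / M_i ≅ (S/P_{F i})(-G i)` as graded modules, for `i = 0, …, r - 1`. -/
def HasPrimeChain (𝓜 : (Fin n →₀ ℕ) → Submodule K M) {r : ℕ}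
    (F G : Fin r → Finset (Fin n)) : Prop :=
  ∃ c : Fin (r + 1) → Submodule (MvPolynomial (Fin n) K) M,
    Monotone c ∧ c 0 = ⊥ ∧ c (Fin.last r) = ⊤ ∧
    (∀ i, IsSquarefreeSubmodule 𝓜 (c i)) ∧
    ∀ i : Fin r, GradedIso
      (quotientGrading (submoduleGrading 𝓜 (c i.succ))
        ((c i.castSucc).submoduleOf (c i.succ)))
      (primeQuotientGrading K (F i) (G i))

end Chains

/-! ## The exterior algebra -/

/-- The exterior algebra `E = K⟨e_1, …, e_n⟩`. -/
abbrev Ext (K : Type u) [Field K] (n : ℕ) : Type u := ExteriorAlgebra K (Fin n → K)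

/-- The generator `e_j`. -/
def e (K : Type u) [Field K] {n : ℕ} (j : Fin n) : Ext K n :=
  ExteriorAlgebra.ι K (Pi.single j 1)

/-- The `ℕ^n`-grading of `E` with `deg e_j = ε_j`. -/
def extGrading (K : Type u) [Field K] {n : ℕ} (a : Fin n →₀ ℕ) : Submodule K (Ext K n) :=
  Submodule.span K {x | ∃ l : List (Fin n),
    (l.map fun j => Finsupp.single j 1).sum = a ∧ x = (l.map (e K)).prod}

/-! Auxiliary facts -/

theorem ind_erase {n : ℕ} {F : Finset (Fin n)} {j : Fin n} (h : j ∈ F) :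
    ind (F.erase j) + Finsupp.single j 1 = ind F := by
  unfold ind
  rw [add_comm]
  exact Finset.add_sum_erase F (fun j => Finsupp.single j 1) h

theorem ind_insert {n : ℕ} {F : Finset (Fin n)} {j : Fin n} (h : j ∉ F) :
    ind (insert j F) = ind F + Finsupp.single j 1 := by
  unfold ind
  rw [Finset.sum_insert h, add_comm]

theorem support_add_single {n : ℕ} (a : Fin n →₀ ℕ) (j : Fin n) :
    (a + Finsupp.single j 1).support = insert j a.support := by
  ext i
  by_cases h : i = j
  · subst h; simp
  · simp [h]

theorem e_mul_self (K : Type u) [Field K] {n : ℕ} (j : Fin n) : e K j * e K j = 0 :=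
  ExteriorAlgebra.ι_sq_zero _

theorem e_mul_comm (K : Type u) [Field K] {n : ℕ} (j k : Fin n) :
    e K j * e K k = -(e K k * e K j) :=
  eq_neg_of_add_eq_zero_left (ExteriorAlgebra.ι_add_mul_swap _ _)

theorem mul_e_mem {K : Type u} [Field K] {n : ℕ} {a : Fin n →₀ ℕ} {x : Ext K n}
    (hx : x ∈ extGrading K a) (j : Fin n) :
    x * e K j ∈ extGrading K (a + Finsupp.single j 1) := by
  unfold extGrading at hx
  induction hx using Submodule.span_induction with
  | mem x hx =>
    obtain ⟨l, rfl, rfl⟩ := hx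
    exact Submodule.subset_span ⟨l ++ [j], by simp, by simp⟩
  | zero => simp
  | add x y _ _ hx hy => rw [add_mul]; exact add_mem hx hy
  | smul c x _ hx => rw [smul_mul_assoc]; exact Submodule.smul_mem _ _ hx

/-- The number of elements of `F` smaller than `j`: `e_j e_F = (-1)^below e_{F ∪ j}`. -/
def below {n : ℕ} (F : Finset (Fin n)) (j : Fin n) : ℕ := (F.filter (· < j)).card

/-- The number `σ(F, {j})` of elements of `F` larger than `j`: `e_F e_j = (-1)^σ e_{F ∪ j}`. -/
def above {n : ℕ} (F : Finset (Fin n)) (j : Fin n) : ℕ := (F.filter (j < ·)).card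

theorem below_erase_sign (K : Type u) [Field K] {n : ℕ} {F : Finset (Fin n)} {j k : Fin n}
    (hj : j ∈ F) (hk : k ∈ F) (hjk : j ≠ k) :
    (-1 : K) ^ below F j * (-1 : K) ^ below (F.erase j) k =
      -((-1 : K) ^ below F k * (-1 : K) ^ below (F.erase k) j) := by
  wlog h : j < k generalizing j k
  · rw [this hk hj hjk.symm (lt_of_le_of_ne (not_lt.mp h) hjk.symm), neg_neg]
  have h1 : below (F.erase k) j = below F j := by
    unfold below
    congr 1
    ext i
    simp only [Finset.mem_filter, Finset.mem_erase]
    constructor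
    · rintro ⟨⟨_, h2⟩, h3⟩; exact ⟨h2, h3⟩
    · rintro ⟨h2, h3⟩; exact ⟨⟨(h3.trans h).ne, h2⟩, h3⟩
  have h2 : below F k = below (F.erase j) k + 1 := by
    unfold below
    rw [Finset.filter_erase, Finset.card_erase_add_one]
    simp [hj, h]
  rw [h1, h2, pow_succ]; ring

theorem above_insert_sign (K : Type u) [Field K] {n : ℕ} {A : Finset (Fin n)} {j k : Fin n}
    (hj : j ∉ A) (hk : k ∉ A) (hjk : j ≠ k) :
    (-1 : K) ^ above (insert k A) j * (-1 : K) ^ above A k =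
      -((-1 : K) ^ above (insert j A) k * (-1 : K) ^ above A j) := by
  wlog h : j < k generalizing j k
  · rw [this hk hj hjk.symm (lt_of_le_of_ne (not_lt.mp h) hjk.symm), neg_neg]
  have h1 : above (insert j A) k = above A k := by
    unfold above
    rw [Finset.filter_insert, if_neg (not_lt.mpr h.le)]
  have h2 : above (insert k A) j = above A j + 1 := by
    unfold above
    rw [Finset.filter_insert, if_pos h, Finset.card_insert_of_notMem]
    simp [hk]
  rw [h1, h2, pow_succ]; ring

/-! ## The functor `𝐅` from squarefree `S`-modules to squarefree `E`-modules -/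

section FunctorF

/-- The vector space `𝐅(M) = ⨁_F M_F`, the sum over all subsets `F` of `{1, …, n}`. -/
def ExtModule {K : Type u} [Field K] {n : ℕ} {M : Type v} [AddCommGroup M] [Module K M]
    (𝓜 : (Fin n →₀ ℕ) → Submodule K M) : Type v :=
  (F : Finset (Fin n)) → 𝓜 (ind F)

variable {K : Type u} [Field K] {n : ℕ} {M : Type v} [AddCommGroup M] [Module K M]
  (𝓜 : (Fin n →₀ ℕ) → Submodule K M)

instance : AddCommGroup (ExtModule 𝓜) :=
  inferInstanceAs (AddCommGroup ((F : Finset (Fin n)) → 𝓜 (ind F)))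

instance : Module K (ExtModule 𝓜) :=
  inferInstanceAs (Module K ((F : Finset (Fin n)) → 𝓜 (ind F)))

/-- The component of degree `F` of an element of `𝐅(M)`. -/
def extComp (F : Finset (Fin n)) : ExtModule 𝓜 →ₗ[K] 𝓜 (ind F) :=
  LinearMap.proj (φ := fun F : Finset (Fin n) => 𝓜 (ind F)) F

/-- The grading of `𝐅(M)`: only squarefree degrees occur, and `𝐅(M)_F = M_F`. -/
def extModuleGrading (a : Fin n →₀ ℕ) : Submodule K (ExtModule 𝓜) where
  carrier := {g | ∀ F, ind F ≠ a → extComp 𝓜 F g = 0}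
  add_mem' hg hg' F hF := by rw [map_add, hg F hF, hg' F hF, add_zero]
  zero_mem' F _ := map_zero _
  smul_mem' c g hg F hF := by rw [map_smul, hg F hF, smul_zero]

theorem extModule_ext {g g' : ExtModule 𝓜}
    (h : ∀ F, (extComp 𝓜 F g : M) = (extComp 𝓜 F g' : M)) : g = g' :=
  funext fun F => Subtype.ext (h F)

variable [Module (MvPolynomial (Fin n) K) M] [IsScalarTower K (MvPolynomial (Fin n) K) M]
  [IsMultigraded 𝓜]

/-- Multiplication by `x_j` as a linear map on `M`. -/
def mulX (K : Type u) [Field K] {n : ℕ} (M : Type v) [AddCommGroup M] [Module K M]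
    [Module (MvPolynomial (Fin n) K) M] [IsScalarTower K (MvPolynomial (Fin n) K) M]
    (j : Fin n) : M →ₗ[K] M :=
  Algebra.lsmul K K M (MvPolynomial.X j : MvPolynomial (Fin n) K)

theorem mulX_mem (j : Fin n) {F : Finset (Fin n)} (h : j ∈ F) :
    ∀ m ∈ 𝓜 (ind (F.erase j)), mulX K M j m ∈ 𝓜 (ind F) := fun m hm =>
  ind_erase h ▸ IsMultigraded.X_smul_mem j (ind (F.erase j)) m hm

/-- The action of `e_j`: an element `w` of degree `F` is sent to `0` if `j ∈ F`, and to
`(-1)^{#{r ∈ F : r < j}} x_j w`, in degree `F ∪ {j}`, if `j ∉ F`. With the convention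
`f w = (-1)^{|f||w|} w f` for `E`-bimodules this is `w e_j = (-1)^{σ(F,{j})} x_j w`. -/
def extAct (j : Fin n) : ExtModule 𝓜 →ₗ[K] ExtModule 𝓜 :=
  LinearMap.pi (φ := fun F : Finset (Fin n) => 𝓜 (ind F)) fun F =>
    if h : j ∈ F then
      (-1 : K) ^ below F j • (mulX K M j).restrict (mulX_mem 𝓜 j h) ∘ₗ extComp 𝓜 (F.erase j)
    else 0

theorem extAct_apply (j : Fin n) (g : ExtModule 𝓜) (F : Finset (Fin n)) :
    (extComp 𝓜 F (extAct 𝓜 j g) : M) = if j ∈ F then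
      (-1 : K) ^ below F j • mulX K M j (extComp 𝓜 (F.erase j) g) else 0 := by
  change (((dite _ _ _ : ExtModule 𝓜 →ₗ[K] 𝓜 (ind F)) g : 𝓜 (ind F)) : M) = _
  by_cases h : j ∈ F <;> simp [h]

theorem extAct_sq (j : Fin n) : extAct 𝓜 j * extAct 𝓜 j = 0 := by
  ext g
  apply extModule_ext
  intro F
  rw [Module.End.mul_apply, extAct_apply, extAct_apply]
  simp

theorem extAct_anticomm {j k : Fin n} (hjk : j ≠ k) :
    extAct 𝓜 j * extAct 𝓜 k + extAct 𝓜 k * extAct 𝓜 j = 0 := by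
  ext g
  apply extModule_ext
  intro F
  simp only [LinearMap.add_apply, Module.End.mul_apply, map_add, Submodule.coe_add,
    extAct_apply, Finset.mem_erase, LinearMap.zero_apply, map_zero, Submodule.coe_zero]
  by_cases hj : j ∈ F
  · by_cases hk : k ∈ F
    · simp only [hj, hk, hjk, hjk.symm, ne_eq, not_false_eq_true, and_self, if_true, map_smul]
      have hc : ∀ m : M, mulX K M j (mulX K M k m) = mulX K M k (mulX K M j m) := fun m =>
        smul_comm (MvPolynomial.X j : MvPolynomial (Fin n) K) (MvPolynomial.X k) m
      rw [Finset.erase_right_comm (a := k) (b := j), smul_smul, smul_smul, hc,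
        below_erase_sign K hj hk hjk, neg_smul, neg_add_cancel]
    · simp [hk]
  · simp [hj]

theorem extLift_sq (w : Fin n → K) :
    (∑ j, w j • extAct 𝓜 j) * (∑ j, w j • extAct 𝓜 j) = 0 := by
  rw [Finset.sum_mul_sum, ← Finset.sum_product']
  refine Finset.sum_involution (fun p _ => (p.2, p.1)) ?_ ?_ (by simp) (by simp)
  · rintro ⟨j, k⟩ _
    simp only [smul_mul_smul_comm]
    rw [mul_comm (w k), ← smul_add]
    by_cases h : j = k
    · subst h; simp [extAct_sq]
    · rw [extAct_anticomm 𝓜 h, smul_zero]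
  · rintro ⟨j, k⟩ _ h1 h2
    have h3 : k = j := congrArg Prod.fst h2
    subst h3
    simp [extAct_sq] at h1

/-- The action of `E` on `𝐅(M)`, extending that of the generators `e_j`. -/
def extHom : Ext K n →ₐ[K] Module.End K (ExtModule 𝓜) :=
  ExteriorAlgebra.lift K
    ⟨∑ j, (LinearMap.proj j : (Fin n → K) →ₗ[K] K).smulRight (extAct 𝓜 j), fun w => by
      simpa using extLift_sq 𝓜 w⟩

theorem extHom_e (j : Fin n) : extHom 𝓜 (e K j) = extAct 𝓜 j := by
  unfold extHom e
  rw [ExteriorAlgebra.lift_ι_apply]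
  simp [Pi.single_apply]

instance : Module (Ext K n) (ExtModule 𝓜) :=
  Module.compHom (ExtModule 𝓜) (extHom 𝓜).toRingHom

theorem ext_smul_def (f : Ext K n) (g : ExtModule 𝓜) : f • g = extHom 𝓜 f g := rfl

instance : IsScalarTower K (Ext K n) (ExtModule 𝓜) :=
  ⟨fun c f g => by simp [ext_smul_def]⟩

end FunctorF

/-! ## The `E`-dual `N^∨ = Hom_E(N, E)`

`N` is a left `E`-module; `Hom_E(N, E)` consists of the left linear maps and is a right
`E`-module (a module over the opposite algebra) through `(φ f)(x) = φ(x) f`. -/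

section EDual

open MulOpposite

/-- Graded right `E`-modules, as far as the action is concerned: `N_a e_j ⊆ N_{a+ε_j}`. -/
class IsRightGraded {K : Type u} [Field K] {n : ℕ} {N : Type v} [AddCommGroup N] [Module K N]
    [Module (Ext K n)ᵐᵒᵖ N] (𝓝 : (Fin n →₀ ℕ) → Submodule K N) : Prop where
  smul_e_mem : ∀ (j : Fin n) (a : Fin n →₀ ℕ), ∀ y ∈ 𝓝 a,
    op (e K j) • y ∈ 𝓝 (a + Finsupp.single j 1)

variable {K : Type u} [Field K] {n : ℕ} {N : Type v} [AddCommGroup N] [Module K N]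
  [Module (Ext K n) N] [IsScalarTower K (Ext K n) N]

variable (K n N) in
/-- The dual `Hom_E(N, E)`. -/
abbrev EDual : Type (max u v) := N →ₗ[Ext K n] Ext K n

/-- The component of degree `a` of `Hom_E(N, E)`: the `φ` with `φ(N_b) ⊆ E_{a+b}` for all `b`. -/
def eDualGrading (𝓝 : (Fin n →₀ ℕ) → Submodule K N) (a : Fin n →₀ ℕ) :
    Submodule K (EDual K n N) where
  carrier := {φ | ∀ b, ∀ x ∈ 𝓝 b, φ x ∈ extGrading K (a + b)}
  add_mem' h h' b x hx := add_mem (h b x hx) (h' b x hx)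
  zero_mem' _ _ _ := zero_mem _
  smul_mem' c _ h b x hx := Submodule.smul_mem _ c (h b x hx)

theorem eDual_smul_apply (f : Ext K n) (φ : EDual K n N) (x : N) :
    (op f • φ) x = φ x * f := rfl

instance (𝓝 : (Fin n →₀ ℕ) → Submodule K N) : IsRightGraded (eDualGrading 𝓝) where
  smul_e_mem j a φ hφ b x hx := by
    rw [eDual_smul_apply, add_right_comm]
    exact mul_e_mem (hφ b x hx) j

end EDual

/-! ## The functor `𝐆` from squarefree `E`-modules to squarefree `S`-modules -/

section FunctorG

open MulOpposite

/-- The vector space `𝐆(N) = ⨁_a N_{supp a}`, the sum over all `a ∈ ℕ^n`. -/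
def PolyModule {K : Type u} [Field K] {n : ℕ} {N : Type v} [AddCommGroup N] [Module K N]
    (𝓝 : (Fin n →₀ ℕ) → Submodule K N) : Type v :=
  DirectSum (Fin n →₀ ℕ) fun a => 𝓝 (ind a.support)

variable {K : Type u} [Field K] {n : ℕ} {N : Type v} [AddCommGroup N] [Module K N]
  (𝓝 : (Fin n →₀ ℕ) → Submodule K N)

instance : AddCommGroup (PolyModule 𝓝) :=
  inferInstanceAs (AddCommGroup (DirectSum (Fin n →₀ ℕ) fun a => 𝓝 (ind a.support)))

instance : Module K (PolyModule 𝓝) :=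
  inferInstanceAs (Module K (DirectSum (Fin n →₀ ℕ) fun a => 𝓝 (ind a.support)))

/-- The inclusion of the summand `N_{supp a}` with index `a`. -/
def polyIncl (a : Fin n →₀ ℕ) : 𝓝 (ind a.support) →ₗ[K] PolyModule 𝓝 :=
  DirectSum.lof K (Fin n →₀ ℕ) (fun a => 𝓝 (ind a.support)) a

/-- The grading of `𝐆(N)`: `𝐆(N)_a = N_{supp a}`. -/
def polyModuleGrading (a : Fin n →₀ ℕ) : Submodule K (PolyModule 𝓝) :=
  LinearMap.range (polyIncl 𝓝 a)

theorem polyIncl_congr {a b : Fin n →₀ ℕ} (h : a = b) {x : 𝓝 (ind a.support)}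
    {y : 𝓝 (ind b.support)} (hxy : (x : N) = y) : polyIncl 𝓝 a x = polyIncl 𝓝 b y := by
  subst h
  rw [Subtype.ext hxy]

/-- Linear maps out of `𝐆(N)` are given on the summands. -/
def polyLift {P : Type*} [AddCommGroup P] [Module K P]
    (f : (a : Fin n →₀ ℕ) → 𝓝 (ind a.support) →ₗ[K] P) : PolyModule 𝓝 →ₗ[K] P :=
  DirectSum.toModule K (Fin n →₀ ℕ) P f

theorem polyLift_incl {P : Type*} [AddCommGroup P] [Module K P]
    (f : (a : Fin n →₀ ℕ) → 𝓝 (ind a.support) →ₗ[K] P) (a : Fin n →₀ ℕ)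
    (y : 𝓝 (ind a.support)) : polyLift 𝓝 f (polyIncl 𝓝 a y) = f a y :=
  DirectSum.toModule_lof (φ := f) K a y

theorem polyModule_hom_ext {P : Type*} [AddCommGroup P] [Module K P]
    {f g : PolyModule 𝓝 →ₗ[K] P} (h : ∀ a x, f (polyIncl 𝓝 a x) = g (polyIncl 𝓝 a x)) : f = g :=
  DirectSum.linearMap_ext (R := K) (M := fun a : Fin n →₀ ℕ => 𝓝 (ind a.support)) (ψ := f)
    (ψ' := g) fun a => LinearMap.ext fun x => h a x

variable [Module (Ext K n)ᵐᵒᵖ N] [IsScalarTower K (Ext K n)ᵐᵒᵖ N]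

/-- How `x_j` acts on elements of `N_A`, where `A = supp a`: by the identity if `j ∈ A`, and by
`y ↦ (-1)^{σ(A,{j})} y e_j` if `j ∉ A`. -/
def stepMap (N : Type v) [AddCommGroup N] [Module K N] [Module (Ext K n)ᵐᵒᵖ N]
    [IsScalarTower K (Ext K n)ᵐᵒᵖ N] (A : Finset (Fin n)) (j : Fin n) : N →ₗ[K] N :=
  if j ∈ A then LinearMap.id
  else (-1 : K) ^ above A j • Algebra.lsmul K K N (op (e K j))

theorem stepMap_comm {j k : Fin n} (A : Finset (Fin n)) (y : N) :
    stepMap (K := K) N (insert k A) j (stepMap (K := K) N A k y) =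
      stepMap (K := K) N (insert j A) k (stepMap (K := K) N A j y) := by
  by_cases hjk : j = k
  · subst hjk; rfl
  by_cases hj : j ∈ A
  · simp [stepMap, hj]
  by_cases hk : k ∈ A
  · simp [stepMap, hk]
  simp only [stepMap, hj, hk, Finset.mem_insert, hjk, Ne.symm hjk, or_self, if_false,
    LinearMap.smul_apply, map_smul, smul_smul, Algebra.lsmul_coe]
  rw [← op_mul, ← op_mul, mul_comm, above_insert_sign K hj hk hjk, e_mul_comm, op_neg, neg_smul, neg_smul,
    smul_neg, neg_neg, mul_comm]

variable [IsRightGraded 𝓝]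

theorem stepMap_mem (a : Fin n →₀ ℕ) (j : Fin n) : ∀ y ∈ 𝓝 (ind a.support),
    stepMap (K := K) N a.support j y ∈ 𝓝 (ind (a + Finsupp.single j 1).support) := by
  intro y hy
  rw [support_add_single]
  by_cases h : j ∈ a.support
  · rw [stepMap, if_pos h, Finset.insert_eq_of_mem h]; exact hy
  · rw [stepMap, if_neg h, ind_insert h]
    exact Submodule.smul_mem _ _ (IsRightGraded.smul_e_mem j _ y hy)

/-- The action of `x_j` on `𝐆(N)`. -/
def polyAct (j : Fin n) : PolyModule 𝓝 →ₗ[K] PolyModule 𝓝 :=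
  polyLift 𝓝 fun a =>
    polyIncl 𝓝 (a + Finsupp.single j 1) ∘ₗ
      (stepMap (K := K) N a.support j).restrict (stepMap_mem 𝓝 a j)

theorem polyAct_incl (j : Fin n) (a : Fin n →₀ ℕ) (y : 𝓝 (ind a.support)) :
    polyAct 𝓝 j (polyIncl 𝓝 a y) = polyIncl 𝓝 (a + Finsupp.single j 1)
      ⟨stepMap (K := K) N a.support j y, stepMap_mem 𝓝 a j y y.2⟩ :=
  polyLift_incl 𝓝 _ a y

theorem polyAct_comm (j k : Fin n) : polyAct 𝓝 j * polyAct 𝓝 k = polyAct 𝓝 k * polyAct 𝓝 j := by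
  apply polyModule_hom_ext
  intro a y
  rw [Module.End.mul_apply, Module.End.mul_apply, polyAct_incl, polyAct_incl, polyAct_incl,
    polyAct_incl]
  apply polyIncl_congr _ (add_right_comm _ _ _)
  change stepMap (K := K) N _ _ (stepMap (K := K) N _ _ _) =
    stepMap (K := K) N _ _ (stepMap (K := K) N _ _ _)
  rw [support_add_single, support_add_single, stepMap_comm]

/-- The action of `S` on `𝐆(N)`, extending that of the variables. -/
def polyHom : MvPolynomial (Fin n) K →ₐ[K] Module.End K (PolyModule 𝓝) :=
  have hcomm : IsMulCommutative (Algebra.adjoin K (Set.range (polyAct 𝓝))) :=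
    Algebra.isMulCommutative_adjoin K (by
      rintro _ ⟨j, rfl⟩ _ ⟨k, rfl⟩
      exact polyAct_comm 𝓝 j k)
  letI : CommRing (Algebra.adjoin K (Set.range (polyAct 𝓝))) :=
    { (Algebra.adjoin K (Set.range (polyAct 𝓝))).toRing with mul_comm := hcomm.is_comm.comm }
  (Algebra.adjoin K (Set.range (polyAct 𝓝))).val.comp
    (MvPolynomial.aeval fun j => ⟨polyAct 𝓝 j, Algebra.subset_adjoin ⟨j, rfl⟩⟩)

theorem polyHom_X (j : Fin n) : polyHom 𝓝 (MvPolynomial.X j) = polyAct 𝓝 j := by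
  unfold polyHom
  simp

instance : Module (MvPolynomial (Fin n) K) (PolyModule 𝓝) :=
  Module.compHom (PolyModule 𝓝) (polyHom 𝓝).toRingHom

theorem poly_smul_def (f : MvPolynomial (Fin n) K) (g : PolyModule 𝓝) :
    f • g = polyHom 𝓝 f g := rfl

instance : IsScalarTower K (MvPolynomial (Fin n) K) (PolyModule 𝓝) :=
  ⟨fun c f g => by simp [poly_smul_def]⟩

end FunctorG

/-! ## The Alexander dual `M^∨ = 𝐆(Hom_E(𝐅(M), E))` -/

section AlexanderDual

variable {K : Type u} [Field K] {n : ℕ} {M : Type v} [AddCommGroup M] [Module K M]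
  [Module (MvPolynomial (Fin n) K) M] [IsScalarTower K (MvPolynomial (Fin n) K) M]
  (𝓜 : (Fin n →₀ ℕ) → Submodule K M) [IsMultigraded 𝓜]

/-- The Alexander dual of a squarefree `S`-module. -/
abbrev AlexanderDual : Type (max u v) :=
  PolyModule (eDualGrading (extModuleGrading 𝓜))

/-- The `ℕ^n`-grading of the Alexander dual. -/
abbrev alexanderDualGrading (a : Fin n →₀ ℕ) : Submodule K (AlexanderDual 𝓜) :=
  polyModuleGrading (eDualGrading (extModuleGrading 𝓜)) a

end AlexanderDual

end

end SqfreeDual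

/-!
A squarefree module `M` is determined by its components `M_A` of squarefree degree `A ⊆ [n]` and
the multiplications `x_j : M_A → M_{A ∪ j}`, `j ∉ A`: every other component is a copy of one of
these (`excess_smul_bijOn`), and squarefree submodules correspond to families of subspaces
`U A ≤ M_A` stable under these maps (`inflateSubmodule`).

In these terms a chain with quotients `(S/P_{F i})(-G i)` is an increasing sequence of such
families in which `F i` and `G i` are disjoint, the `i`-th step has codimension one in the degrees
`A` of the interval from `G i` to the complement of `F i`, with multiplication by the variables
injective on the quotients inside this interval, and is trivial in all other degrees (`CubeChain`,
`HasPrimeChain.exists_cubeChain`, `CubeChain.hasPrimeChain`). In particular `F i ∩ G i = ∅` is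
forced, since a variable `x_j` with `j ∈ F i ∩ G i` would be both zero and injective on the
generator of the quotient.

The Alexander dual is paired with `M` by `⟨v, φ⟩ = [e_1 ⋯ e_n] φ(v)`. This pairing puts `M_A` in
perfect duality with the component of `M^∨` of degree `Aᶜ`, because the exterior algebra is
a Frobenius algebra (`eDual_eq_zero`, `exists_eDual`), and `x_j` is adjoint to itself up to sign
(`isComplementPairing_alexanderPairing`). Hence `U ↦ U^⊥` turns a chain in `M` into a chain
in `M^∨`: it reverses inclusions, replaces degrees by their complements, and so maps the interval
from `G` to the complement of `F` to the interval from `F` to the complement of `G`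
(`CubeChain.annihilator`). Signs play no role for annihilators. The situation is symmetric in `M`
and `M^∨`, so the converse is the same statement for the flipped pairing, and no identification of
`M^∨∨` with `M` is needed.
-/

namespace SqfreeDual

universe u v

noncomputable section

/-! ### Squarefree exponent vectors -/

theorem ind_apply {n : ℕ} (F : Finset (Fin n)) (i : Fin n) : ind F i = if i ∈ F then 1 else 0 := by
  simp [ind, Finsupp.single_apply, Finsupp.finsetSum_apply]

theorem support_ind {n : ℕ} (F : Finset (Fin n)) : (ind F).support = F := by
  ext i
  simp [ind_apply]

theorem ind_injective {n : ℕ} : Function.Injective (ind : Finset (Fin n) → Fin n →₀ ℕ) :=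
  fun A B h => by rw [← support_ind A, h, support_ind]

theorem ind_support_le {n : ℕ} (a : Fin n →₀ ℕ) : ind a.support ≤ a := fun i => by
  rw [ind_apply]
  split_ifs with h
  · exact Nat.one_le_iff_ne_zero.mpr (Finsupp.mem_support_iff.mp h)
  · exact Nat.zero_le _

/-- The exponent vector `a - ind (supp a)`: multiplication by the monomial with this exponent
carries degree `supp a` to degree `a`. -/
def excess {n : ℕ} (a : Fin n →₀ ℕ) : Fin n →₀ ℕ := a - ind a.support

theorem ind_support_add_excess {n : ℕ} (a : Fin n →₀ ℕ) : ind a.support + excess a = a :=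
  add_tsub_cancel_of_le (ind_support_le a)

theorem excess_support_subset {n : ℕ} (a : Fin n →₀ ℕ) : (excess a).support ⊆ a.support :=
  Finsupp.support_tsub

theorem excess_ind {n : ℕ} (A : Finset (Fin n)) : excess (ind A) = 0 := by
  rw [excess, support_ind, tsub_self]

theorem excess_add_of_mem {n : ℕ} {a : Fin n →₀ ℕ} {j : Fin n} (h : j ∈ a.support) :
    excess (a + Finsupp.single j 1) = excess a + Finsupp.single j 1 := by
  apply add_left_cancel (a := ind a.support)
  have h1 : (a + Finsupp.single j 1).support = a.support := by
    rw [support_add_single, Finset.insert_eq_of_mem h]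
  have h2 := ind_support_add_excess (a + Finsupp.single j 1)
  rw [h1] at h2
  rw [h2, ← add_assoc, ind_support_add_excess]

theorem excess_add_of_notMem {n : ℕ} {a : Fin n →₀ ℕ} {j : Fin n} (h : j ∉ a.support) :
    excess (a + Finsupp.single j 1) = excess a := by
  apply add_left_cancel (a := ind a.support + Finsupp.single j 1)
  have h2 := ind_support_add_excess (a + Finsupp.single j 1)
  rw [support_add_single, ind_insert h] at h2
  rw [h2, add_right_comm, ind_support_add_excess]

theorem exponent_induction {n : ℕ} {p : (Fin n →₀ ℕ) → Prop} (zero : p 0)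
    (add_single : ∀ b j, p b → p (b + Finsupp.single j 1)) (b : Fin n →₀ ℕ) : p b := by
  obtain ⟨k, hk⟩ : ∃ k, b.degree = k := ⟨_, rfl⟩
  induction k generalizing b with
  | zero => rwa [(Finsupp.degree_eq_zero_iff b).mp hk]
  | succ k ih =>
    obtain ⟨j, hj⟩ : ∃ j, b j ≠ 0 := by
      by_contra! h
      have h0 : b = 0 := Finsupp.ext h
      simp [h0] at hk
    have hb : b - Finsupp.single j 1 + Finsupp.single j 1 = b :=
      tsub_add_cancel_of_le (Finsupp.single_le_iff.mpr (Nat.one_le_iff_ne_zero.mpr hj))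
    rw [← hb]
    refine add_single _ j (ih _ ?_)
    have := congrArg Finsupp.degree hb
    rw [map_add, Finsupp.degree_single, hk] at this
    exact Nat.succ.inj this

/-! ### Components of multigraded modules -/

section Components

open MvPolynomial

variable {K : Type u} [Field K] {n : ℕ} {M : Type v} [AddCommGroup M] [Module K M]
  [Module (MvPolynomial (Fin n) K) M]

/-- The projection of `M` onto its component of degree `a`. -/
def proj (𝓜 : (Fin n →₀ ℕ) → Submodule K M) [IsMultigraded 𝓜] (a : Fin n →₀ ℕ) :
    M →ₗ[K] 𝓜 a :=
  letI := (IsMultigraded.isInternal (𝓜 := 𝓜)).chooseDecomposition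
  DirectSum.component K (Fin n →₀ ℕ) (fun a => 𝓜 a) a ∘ₗ
    (DirectSum.decomposeLinearEquiv 𝓜).toLinearMap

variable {𝓜 : (Fin n →₀ ℕ) → Submodule K M} [IsMultigraded 𝓜]

theorem proj_of_mem {a : Fin n →₀ ℕ} {m : M} (h : m ∈ 𝓜 a) : (proj 𝓜 a m : M) = m := by
  let _ := (IsMultigraded.isInternal (𝓜 := 𝓜)).chooseDecomposition
  exact DirectSum.decompose_of_mem_same 𝓜 h

theorem proj_of_mem_ne {a b : Fin n →₀ ℕ} {m : M} (h : m ∈ 𝓜 a) (hab : a ≠ b) :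
    proj 𝓜 b m = 0 := by
  let _ := (IsMultigraded.isInternal (𝓜 := 𝓜)).chooseDecomposition
  exact Subtype.ext (DirectSum.decompose_of_mem_ne 𝓜 h hab)

variable (𝓜) in
theorem iSup_grading : ⨆ a, 𝓜 a = ⊤ :=
  (IsMultigraded.isInternal (𝓜 := 𝓜)).submodule_iSup_eq_top

/-- The components of an element of a graded submodule lie in the corresponding components. -/
theorem proj_mem_of_mem_iSup {T : (Fin n →₀ ℕ) → Submodule K M} (hT : ∀ a, T a ≤ 𝓜 a) {m : M}
    (h : m ∈ ⨆ a, T a) (a : Fin n →₀ ℕ) : (proj 𝓜 a m : M) ∈ T a := by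
  induction h using Submodule.iSup_induction' with
  | mem b x hx =>
    by_cases hb : b = a
    · subst hb; rwa [proj_of_mem (hT _ hx)]
    · rw [proj_of_mem_ne (hT _ hx) hb]; exact zero_mem _
  | zero => simp
  | add x y _ _ hx hy => rw [map_add]; exact add_mem hx hy

theorem mem_of_mem_iSup {T : (Fin n →₀ ℕ) → Submodule K M} (hT : ∀ a, T a ≤ 𝓜 a) {m : M}
    (h : m ∈ ⨆ a, T a) {a : Fin n →₀ ℕ} (ha : m ∈ 𝓜 a) : m ∈ T a := by
  have := proj_mem_of_mem_iSup hT h a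
  rwa [proj_of_mem ha] at this

theorem smul_mem_of_X_smul_mem [IsScalarTower K (MvPolynomial (Fin n) K) M] {L : Submodule K M}
    (h : ∀ j, ∀ m ∈ L, (X j : MvPolynomial (Fin n) K) • m ∈ L) (f : MvPolynomial (Fin n) K) :
    ∀ m ∈ L, f • m ∈ L := by
  induction f using MvPolynomial.induction_on with
  | C c => intro m hm; rw [← algebraMap_eq, algebraMap_smul]; exact L.smul_mem c hm
  | add p q hp hq => intro m hm; rw [add_smul]; exact add_mem (hp m hm) (hq m hm)
  | mul_X p j hp => intro m hm; rw [mul_smul]; exact hp _ (h j m hm)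

omit [Module K M] in
theorem monomial_add_single_smul (b : Fin n →₀ ℕ) (j : Fin n) (m : M) :
    (monomial (b + Finsupp.single j 1) 1 : MvPolynomial (Fin n) K) • m =
      (X j : MvPolynomial (Fin n) K) • (monomial b 1 : MvPolynomial (Fin n) K) • m := by
  rw [smul_smul, add_comm, X, monomial_mul, one_mul]

variable [IsScalarTower K (MvPolynomial (Fin n) K) M]

/-- The `S`-submodule of `M` which is the sum of a family of subspaces of the components that is
closed under multiplication by the variables. -/
def ofComponents (T : (Fin n →₀ ℕ) → Submodule K M)
    (hX : ∀ j a, ∀ m ∈ T a, (X j : MvPolynomial (Fin n) K) • m ∈ T (a + Finsupp.single j 1)) :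
    Submodule (MvPolynomial (Fin n) K) M where
  __ := ⨆ a, T a
  smul_mem' f m hm := by
    refine smul_mem_of_X_smul_mem (L := ⨆ a, T a) (fun j m hm => ?_) f m hm
    induction hm using Submodule.iSup_induction' with
    | mem a x hx => exact Submodule.mem_iSup_of_mem _ (hX j a x hx)
    | zero => simp
    | add x y _ _ hx hy => rw [smul_add]; exact add_mem hx hy

omit [IsScalarTower K (MvPolynomial (Fin n) K) M] in
theorem monomial_smul_mem {a : Fin n →₀ ℕ} {m : M} (hm : m ∈ 𝓜 a) (b : Fin n →₀ ℕ) :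
    (monomial b 1 : MvPolynomial (Fin n) K) • m ∈ 𝓜 (a + b) := by
  induction b using exponent_induction with
  | zero => simpa using hm
  | add_single b j ih =>
    rw [monomial_add_single_smul, ← add_assoc]
    exact IsMultigraded.X_smul_mem j _ _ ih

omit [IsMultigraded 𝓜] [IsScalarTower K (MvPolynomial (Fin n) K) M] in
theorem monomial_smul_bijOn (hbij : ∀ (a : Fin n →₀ ℕ), ∀ i ∈ a.support,
      Set.BijOn (fun m : M => (X i : MvPolynomial (Fin n) K) • m)
        (𝓜 a) (𝓜 (a + Finsupp.single i 1)))
    (a b : Fin n →₀ ℕ) (h : b.support ⊆ a.support) :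
    Set.BijOn (fun m : M => (monomial b 1 : MvPolynomial (Fin n) K) • m) (𝓜 a) (𝓜 (a + b)) := by
  induction b using exponent_induction with
  | zero => simpa using! Set.bijOn_id (𝓜 a : Set M)
  | add_single b j ih =>
    rw [support_add_single, Finset.insert_subset_iff] at h
    rw [← add_assoc]
    refine ((hbij (a + b) j ?_).comp (ih h.2)).congr
      fun m _ => (monomial_add_single_smul b j m).symm
    have := Finsupp.mem_support_iff.mp h.1
    simp [this]

omit [IsMultigraded 𝓜] [IsScalarTower K (MvPolynomial (Fin n) K) M] in
/-- Every component of a squarefree module is a copy of a component of squarefree degree. -/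
theorem excess_smul_bijOn (hbij : ∀ (a : Fin n →₀ ℕ), ∀ i ∈ a.support,
      Set.BijOn (fun m : M => (X i : MvPolynomial (Fin n) K) • m)
        (𝓜 a) (𝓜 (a + Finsupp.single i 1))) (a : Fin n →₀ ℕ) :
    Set.BijOn (fun m : M => (monomial (excess a) 1 : MvPolynomial (Fin n) K) • m)
      (𝓜 (ind a.support)) (𝓜 a) := by
  have := monomial_smul_bijOn hbij (ind a.support) (excess a)
    (by rw [support_ind]; exact excess_support_subset a)
  rwa [ind_support_add_excess] at this

theorem isMultigraded_ofComponents {T : (Fin n →₀ ℕ) → Submodule K M} (hT : ∀ a, T a ≤ 𝓜 a)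
    (hX : ∀ j a, ∀ m ∈ T a, (X j : MvPolynomial (Fin n) K) • m ∈ T (a + Finsupp.single j 1)) :
    IsMultigraded (submoduleGrading 𝓜 (ofComponents T hX)) where
  isInternal := by
    rw [DirectSum.isInternal_submodule_iff_iSupIndep_and_iSup_eq_top]
    constructor
    · rw [iSupIndep_def]
      intro a
      rw [Submodule.disjoint_def]
      intro m hm hm'
      have h : ⨆ b, ⨆ (_ : b ≠ a), submoduleGrading 𝓜 (ofComponents T hX) b ≤
          LinearMap.ker (proj 𝓜 a ∘ₗ (ofComponents T hX).subtype.restrictScalars K) :=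
        iSup₂_le fun b hb x hx => proj_of_mem_ne (𝓜 := 𝓜) hx hb
      have h1 : proj 𝓜 a (m : M) = 0 := h hm'
      apply Subtype.ext
      exact (proj_of_mem (𝓜 := 𝓜) (m := (m : M)) hm).symm.trans (congrArg Subtype.val h1)
    · rw [eq_top_iff]
      rintro ⟨m, hm⟩ -
      have h : ⨆ a, T a ≤ (⨆ a, submoduleGrading 𝓜 (ofComponents T hX) a).map
          ((ofComponents T hX).subtype.restrictScalars K) := by
        refine iSup_le fun a x hx => ?_
        exact ⟨⟨x, Submodule.mem_iSup_of_mem a hx⟩,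
          Submodule.mem_iSup_of_mem a (hT a hx), rfl⟩
      obtain ⟨x, hx, rfl⟩ := h hm
      exact hx
  X_smul_mem i a m hm := IsMultigraded.X_smul_mem (𝓜 := 𝓜) i a m hm

variable (𝓜) in
/-- The components of a finitely generated multigraded module are finite dimensional, since
a strictly increasing chain of subspaces of `M_a` generates one of submodules of `M`. -/
theorem finiteDimensional_component [Module.Finite (MvPolynomial (Fin n) K) M]
    (a : Fin n →₀ ℕ) : FiniteDimensional K (𝓜 a) := by
  classical
  -- `T W` contains `W` in degree `a` and everything in the larger degrees.
  let T : Submodule K (𝓜 a) → (Fin n →₀ ℕ) → Submodule K M := fun W b =>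
    if b = a then W.map (𝓜 a).subtype else if a ≤ b then 𝓜 b else ⊥
  have hT : ∀ W b, T W b ≤ 𝓜 b := by
    intro W b
    dsimp only [T]
    split_ifs with h1 h2
    · subst h1; exact Submodule.map_subtype_le _ _
    · exact le_rfl
    · exact bot_le
  have hX : ∀ W j b, ∀ m ∈ T W b,
      (X j : MvPolynomial (Fin n) K) • m ∈ T W (b + Finsupp.single j 1) := by
    intro W j b m hm
    by_cases hab : a ≤ b
    · have h1 : b + Finsupp.single j 1 ≠ a := by
        intro h
        have := hab j
        rw [← h] at this
        simp at this
      have h2 : a ≤ b + Finsupp.single j 1 := hab.trans le_self_add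
      dsimp only [T]
      rw [if_neg h1, if_pos h2]
      exact IsMultigraded.X_smul_mem j b m (hT W b hm)
    · have h1 : b ≠ a := fun h => hab h.ge
      simp only [T, if_neg h1, if_neg hab, Submodule.mem_bot] at hm
      rw [hm, smul_zero]
      exact zero_mem _
  have hmem : ∀ W (x : 𝓜 a), x ∈ W ↔ (x : M) ∈ ofComponents (T W) (hX W) := by
    intro W x
    constructor
    · intro hx
      exact Submodule.mem_iSup_of_mem a (by simpa [T] using hx)
    · intro hx
      have := mem_of_mem_iSup (hT W) hx x.2
      simpa [T] using this
  have hmono : StrictMono fun W => ofComponents (T W) (hX W) := by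
    refine Monotone.strictMono_of_injective ?_ ?_
    · intro W W' h
      have h' : ⨆ b, T W b ≤ ⨆ b, T W' b := by
        refine iSup_mono fun b => ?_
        dsimp only [T]
        split_ifs
        exacts [Submodule.map_mono h, le_rfl, le_rfl]
      exact h'
    · intro W W' h
      ext x
      rw [hmem, hmem]
      exact iff_of_eq (congrArg ((x : M) ∈ ·) h)
  have : WellFoundedGT (Submodule K (𝓜 a)) := hmono.wellFoundedGT
  exact IsNoetherian.iff_fg.mp (isNoetherian_iff'.mpr this)

variable (𝓜) in
/-- A multigraded module with bijective multiplications as in the definition of squarefree modules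
is finitely generated as soon as its components of squarefree degree are finite dimensional. -/
theorem finite_of_finiteDimensional (hbij : ∀ (a : Fin n →₀ ℕ), ∀ i ∈ a.support,
      Set.BijOn (fun m : M => (X i : MvPolynomial (Fin n) K) • m)
        (𝓜 a) (𝓜 (a + Finsupp.single i 1)))
    (hfin : ∀ A : Finset (Fin n), FiniteDimensional K (𝓜 (ind A))) :
    Module.Finite (MvPolynomial (Fin n) K) M := by
  have hfg : ∀ A : Finset (Fin n), (𝓜 (ind A)).FG := fun A => Module.Finite.iff_fg.mp (hfin A)
  choose s hs using hfg
  classical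
  refine ⟨⟨Finset.univ.biUnion s, ?_⟩⟩
  set L := Submodule.span (MvPolynomial (Fin n) K) (↑(Finset.univ.biUnion s) : Set M)
  suffices h : (⊤ : Submodule K M) ≤ L.restrictScalars K from
    eq_top_iff.mpr fun x _ => h Submodule.mem_top
  rw [← iSup_grading 𝓜]
  refine iSup_le fun a x hx => ?_
  obtain ⟨y, hy, rfl⟩ := (excess_smul_bijOn hbij a).surjOn hx
  refine L.smul_mem _ ?_
  have h1 : 𝓜 (ind a.support) ≤ L.restrictScalars K := by
    rw [← hs, Submodule.span_le]
    intro z hz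
    exact Submodule.subset_span (by
      simp only [Finset.coe_biUnion, Set.mem_iUnion]
      exact ⟨_, Finset.mem_coe.mpr (Finset.mem_univ _), hz⟩)
  exact h1 hy

end Components

/-! ### Prime chains in terms of the components of squarefree degree -/

section CubeChains

open MvPolynomial

/-- `V / (U ∩ V)` is one-dimensional; for `U ≤ V` this says that `U` has codimension one in `V`. -/
def IsLineOver {K : Type u} [Field K] {M : Type v} [AddCommGroup M] [Module K M]
    (U V : Submodule K M) : Prop :=
  ∃ w ∈ V, w ∉ U ∧ ∀ v ∈ V, ∃ c : K, v - c • w ∈ U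

theorem IsLineOver.exists_sub_smul_mem {K : Type u} [Field K] {M : Type v} [AddCommGroup M]
    [Module K M] {U V : Submodule K M} (h : IsLineOver U V) {w : M} (hw : w ∈ V) (hw' : w ∉ U)
    {v : M} (hv : v ∈ V) : ∃ c : K, v - c • w ∈ U := by
  obtain ⟨w₀, -, -, h⟩ := h
  obtain ⟨c, hc⟩ := h w hw
  obtain ⟨d, hd⟩ := h v hv
  have hc0 : c ≠ 0 := by
    rintro rfl
    exact hw' (by simpa using hc)
  refine ⟨d * c⁻¹, ?_⟩
  have h1 := sub_mem hd (U.smul_mem (d * c⁻¹) hc)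
  have h2 : v - d • w₀ - (d * c⁻¹) • (w - c • w₀) = v - (d * c⁻¹) • w := by
    rw [smul_sub, smul_smul, inv_mul_cancel_right₀ hc0]
    abel
  rwa [h2] at h1

variable {K : Type u} [Field K] {n : ℕ} {M : Type v} [AddCommGroup M] [Module K M]
  [Module (MvPolynomial (Fin n) K) M]

/-- The trace of a prime chain on the components of squarefree degree. The subspaces `U i A` of
`M_A` are the components of the members of the chain; the `i`-th quotient is `K` in the degrees
`A` with `G i ⊆ A` and `A ∩ F i = ∅`, with injective multiplication between these degrees, and
zero in the other squarefree degrees. -/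
structure CubeChain (𝓜 : (Fin n →₀ ℕ) → Submodule K M) {r : ℕ} (F G : Fin r → Finset (Fin n))
    (U : Fin (r + 1) → Finset (Fin n) → Submodule K M) : Prop where
  le_grading : ∀ i A, U i A ≤ 𝓜 (ind A)
  mono : ∀ A, Monotone fun i => U i A
  zero_eq : ∀ A, U 0 A = ⊥
  last_eq : ∀ A, U (Fin.last r) A = 𝓜 (ind A)
  X_smul_mem : ∀ i A, ∀ j ∉ A, ∀ m ∈ U i A,
    (X j : MvPolynomial (Fin n) K) • m ∈ U i (insert j A)
  disjoint : ∀ i, Disjoint (F i) (G i)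
  line : ∀ i A, G i ⊆ A → Disjoint (F i) A → IsLineOver (U i.castSucc A) (U i.succ A)
  le_of_not : ∀ i A, ¬(G i ⊆ A ∧ Disjoint (F i) A) → U i.succ A ≤ U i.castSucc A
  mem_of_X_smul_mem : ∀ i A, ∀ j ∉ A, G i ⊆ A → Disjoint (F i) (insert j A) → ∀ m ∈ U i.succ A,
    (X j : MvPolynomial (Fin n) K) • m ∈ U i.castSucc (insert j A) → m ∈ U i.castSucc A

/-! ### The components of `(S/P_F)(-G)` -/

theorem ind_le_ind {n : ℕ} {A B : Finset (Fin n)} : ind A ≤ ind B ↔ A ⊆ B := by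
  constructor
  · intro h i hi
    have := h i
    rw [ind_apply, ind_apply, if_pos hi] at this
    by_contra hB
    simp [hB] at this
  · intro h i
    rw [ind_apply, ind_apply]
    split_ifs with h1 h2
    exacts [le_rfl, absurd (h h1) h2, Nat.zero_le _, le_rfl]

theorem ind_sdiff_add {n : ℕ} {A B : Finset (Fin n)} (h : B ⊆ A) : ind (A \ B) + ind B = ind A :=
  Finset.sum_sdiff h

theorem mk_monomial_eq_zero_iff {F : Finset (Fin n)} {b : Fin n →₀ ℕ} :
    Ideal.Quotient.mk (primeIdeal K F) (monomial b 1) = 0 ↔ ∃ i ∈ F, b i ≠ 0 := by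
  classical
  rw [Ideal.Quotient.eq_zero_iff_mem, primeIdeal, mem_ideal_span_X_image,
    support_monomial, if_neg one_ne_zero]
  simp

theorem mem_primeQuotientGrading_iff {F G : Finset (Fin n)} {b : Fin n →₀ ℕ}
    {y : MvPolynomial (Fin n) K ⧸ primeIdeal K F} :
    y ∈ primeQuotientGrading K F G (b + ind G) ↔
      ∃ c : K, c • Ideal.Quotient.mk (primeIdeal K F) (monomial b 1) = y := by
  rw [← Submodule.mem_span_singleton, primeQuotientGrading]
  suffices h : {q | ∃ b' : Fin n →₀ ℕ, b' + ind G = b + ind G ∧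
      q = Ideal.Quotient.mk (primeIdeal K F) (monomial b' 1)} =
      {Ideal.Quotient.mk (primeIdeal K F) (monomial b 1)} by rw [h]
  ext q
  simp

theorem primeQuotientGrading_eq_bot {F G : Finset (Fin n)} {a : Fin n →₀ ℕ} (h : ¬ ind G ≤ a) :
    primeQuotientGrading K F G a = ⊥ := by
  rw [primeQuotientGrading, Submodule.span_eq_bot]
  rintro _ ⟨b, rfl, -⟩
  exact absurd le_add_self h

/-! ### From prime chains to their components of squarefree degree -/

variable [IsScalarTower K (MvPolynomial (Fin n) K) M]

/-- A graded isomorphism of `L' / L` with `B`, read as a homomorphism from `L'` with kernel `L` that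
is surjective in each degree. -/
theorem exists_hom_of_gradedIso {𝓜 : (Fin n →₀ ℕ) → Submodule K M}
    {L L' : Submodule (MvPolynomial (Fin n) K) M} {B : Type*} [AddCommGroup B] [Module K B]
    [Module (MvPolynomial (Fin n) K) B] {𝓑 : (Fin n →₀ ℕ) → Submodule K B}
    (h : GradedIso (quotientGrading (submoduleGrading 𝓜 L') (L.submoduleOf L')) 𝓑) :
    ∃ q : L' →ₗ[MvPolynomial (Fin n) K] B, (∀ x, q x = 0 ↔ (x : M) ∈ L) ∧
      (∀ a (x : L'), (x : M) ∈ 𝓜 a → q x ∈ 𝓑 a) ∧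
      (∀ a, ∀ y ∈ 𝓑 a, ∃ x : L', (x : M) ∈ 𝓜 a ∧ q x = y) := by
  obtain ⟨f, hf⟩ := h
  refine ⟨f.toLinearMap ∘ₗ (L.submoduleOf L').mkQ, fun x => ?_, fun a x hx => ?_, fun a y hy => ?_⟩
  · exact (map_eq_zero_iff f f.injective).trans (Submodule.Quotient.mk_eq_zero _)
  · exact (hf a _).mp ⟨x, hx, rfl⟩
  · have h1 : f.symm y ∈ quotientGrading (submoduleGrading 𝓜 L') (L.submoduleOf L') a :=
      (hf a _).mpr (by simpa using hy)
    obtain ⟨x, hx, hxy⟩ := h1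
    refine ⟨x, hx, ?_⟩
    have h2 : (L.submoduleOf L').mkQ x = f.symm y := hxy
    rw [LinearMap.comp_apply, h2]
    simp

theorem HasPrimeChain.exists_cubeChain {𝓜 : (Fin n →₀ ℕ) → Submodule K M} [IsSquarefreeModule 𝓜]
    {r : ℕ} {F G : Fin r → Finset (Fin n)} (h : HasPrimeChain 𝓜 F G) :
    ∃ U, CubeChain 𝓜 F G U := by
  obtain ⟨c, hmono, h0, hlast, hsq, hiso⟩ := h
  choose q hq0 hqmem hqsurj using fun i => exists_hom_of_gradedIso (hiso i)
  have hdisj : ∀ i, Disjoint (F i) (G i) := by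
    intro i
    rw [Finset.disjoint_left]
    intro j hjF hjG
    obtain ⟨x, hx, hx1⟩ := hqsurj i (ind (G i)) (Ideal.Quotient.mk _ (monomial 0 1)) (by
      have := (mem_primeQuotientGrading_iff (K := K) (F := F i) (G := G i) (b := 0)
        (y := Ideal.Quotient.mk _ (monomial 0 1))).mpr ⟨1, one_smul _ _⟩
      rwa [zero_add] at this)
    have hj : j ∈ (ind (G i)).support := by rwa [support_ind]
    -- `x_j` annihilates the class of `x`, but acts injectively on it as `j ∈ G i`.
    have h1 : (X j : MvPolynomial (Fin n) K) • (x : M) ∈ c i.castSucc := by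
      have h2 : q i ((X j : MvPolynomial (Fin n) K) • x) = 0 := by
        rw [map_smul, hx1, ← Ideal.Quotient.mk_eq_mk, ← Submodule.Quotient.mk_smul,
          Submodule.Quotient.mk_eq_zero]
        exact Ideal.mul_mem_right _ _ (Ideal.subset_span ⟨j, hjF, rfl⟩)
      exact (hq0 i _).mp h2
    obtain ⟨g, hg, hgx⟩ := ((hsq i.castSucc).bijOn (ind (G i)) j hj).surjOn
      (show (⟨_, h1⟩ : c i.castSucc) ∈ _ from IsMultigraded.X_smul_mem (𝓜 := 𝓜) j _ _ hx)
    have h3 : (g : M) = x := (IsSquarefreeModule.bijOn (𝓜 := 𝓜) (ind (G i)) j hj).injOn hg hx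
      (congrArg Subtype.val hgx)
    have h4 := (hq0 i x).mpr (h3 ▸ g.2)
    rw [hx1, mk_monomial_eq_zero_iff] at h4
    simp at h4
  have hmk : ∀ i A, Disjoint (F i) A → Ideal.Quotient.mk (primeIdeal K (F i))
      (monomial (ind (A \ G i)) 1) ≠ 0 := by
    intro i A hA h
    obtain ⟨j, hj, hj'⟩ := mk_monomial_eq_zero_iff.mp h
    refine Finset.disjoint_left.mp hA hj ?_
    by_contra hjA
    simp [ind_apply, hjA] at hj'
  have hval : ∀ i A, G i ⊆ A → ∀ x : c i.succ, (x : M) ∈ 𝓜 (ind A) →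
      ∃ d : K, d • Ideal.Quotient.mk (primeIdeal K (F i)) (monomial (ind (A \ G i)) 1) = q i x := by
    intro i A hGA x hx
    have := hqmem i _ x hx
    rwa [← ind_sdiff_add hGA, mem_primeQuotientGrading_iff] at this
  refine ⟨fun i A => (c i).restrictScalars K ⊓ 𝓜 (ind A), ?_⟩
  refine ⟨fun i A => inf_le_right, fun A i i' hi => inf_le_inf_right _ (hmono hi), ?_, ?_, ?_,
    hdisj, ?_, ?_, ?_⟩
  · intro A
    simp [h0]
  · intro A
    simp [hlast]
  · intro i A j hj m hm
    refine ⟨(c i).smul_mem _ hm.1, ?_⟩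
    rw [ind_insert hj]
    exact IsMultigraded.X_smul_mem j _ m hm.2
  · intro i A hGA hFA
    obtain ⟨x, hx, hxy⟩ := hqsurj i (ind A)
      (Ideal.Quotient.mk _ (monomial (ind (A \ G i)) 1)) (by
        rw [← ind_sdiff_add hGA]
        exact mem_primeQuotientGrading_iff.mpr ⟨1, one_smul _ _⟩)
    refine ⟨x, ⟨x.2, hx⟩, fun h => hmk i A hFA ?_, fun v hv => ?_⟩
    · rw [← hxy]
      exact (hq0 i x).mpr h.1
    · obtain ⟨d, hd⟩ := hval i A hGA ⟨v, hv.1⟩ hv.2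
      refine ⟨d, (hq0 i ((⟨v, hv.1⟩ : c i.succ) - d • x)).mp ?_,
        sub_mem hv.2 (Submodule.smul_mem _ d hx)⟩
      rw [map_sub, LinearMap.map_smul_of_tower, hxy, hd, sub_self]
  · intro i A hA v hv
    refine ⟨(hq0 i ⟨v, hv.1⟩).mp ?_, hv.2⟩
    by_cases hGA : G i ⊆ A
    · have hFA : ¬ Disjoint (F i) A := fun h => hA ⟨hGA, h⟩
      obtain ⟨j, hjF, hjA⟩ := Finset.not_disjoint_iff.mp hFA
      obtain ⟨d, hd⟩ := hval i A hGA ⟨v, hv.1⟩ hv.2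
      rw [← hd, mk_monomial_eq_zero_iff.mpr ⟨j, hjF, ?_⟩, smul_zero]
      simp [ind_apply, hjA, Finset.disjoint_left.mp (hdisj i) hjF]
    · have := hqmem i (ind A) ⟨v, hv.1⟩ hv.2
      rwa [primeQuotientGrading_eq_bot (mt ind_le_ind.mp hGA), Submodule.mem_bot] at this
  · intro i A j hj hGA hFA v hv hXv
    refine ⟨(hq0 i ⟨v, hv.1⟩).mp ?_, hv.2⟩
    obtain ⟨d, hd⟩ := hval i A hGA ⟨v, hv.1⟩ hv.2
    have h1 := (hq0 i ((X j : MvPolynomial (Fin n) K) • (⟨v, hv.1⟩ : c i.succ))).mpr hXv.1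
    rw [map_smul, ← hd, smul_comm] at h1
    have h2 : (X j : MvPolynomial (Fin n) K) •
        Ideal.Quotient.mk (primeIdeal K (F i)) (monomial (ind (A \ G i)) 1) =
        Ideal.Quotient.mk (primeIdeal K (F i)) (monomial (ind (insert j A \ G i)) 1) := by
      rw [← Ideal.Quotient.mk_eq_mk, ← Submodule.Quotient.mk_smul, Ideal.Quotient.mk_eq_mk,
        Finset.insert_sdiff_of_notMem _ (fun h => hj (hGA h)),
        ind_insert (fun h => hj (Finset.sdiff_subset h)), smul_eq_mul, X, monomial_mul, one_mul,
        add_comm]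
    rw [h2, smul_eq_zero] at h1
    rw [← hd, h1.resolve_right (hmk i _ hFA), zero_smul]

end CubeChains

/-! ### Squarefree submodules from their components of squarefree degree -/

section Inflate

open MvPolynomial

variable {K : Type u} [Field K] {n : ℕ} {M : Type v} [AddCommGroup M] [Module K M]
  [Module (MvPolynomial (Fin n) K) M] [IsScalarTower K (MvPolynomial (Fin n) K) M]

/-- The component of degree `a` of the squarefree submodule whose components of squarefree degree
are the `U A`. -/
def inflate (U : Finset (Fin n) → Submodule K M) (a : Fin n →₀ ℕ) : Submodule K M :=
  (U a.support).map (Algebra.lsmul K K M (monomial (excess a) 1 : MvPolynomial (Fin n) K))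

theorem mem_inflate {U : Finset (Fin n) → Submodule K M} {a : Fin n →₀ ℕ} {m : M} :
    m ∈ inflate U a ↔
      ∃ u ∈ U a.support, (monomial (excess a) 1 : MvPolynomial (Fin n) K) • u = m := Iff.rfl

theorem inflate_ind (U : Finset (Fin n) → Submodule K M) (A : Finset (Fin n)) :
    inflate U (ind A) = U A := by
  ext m
  rw [mem_inflate, excess_ind, support_ind]
  simp

theorem X_smul_mem_inflate {U : Finset (Fin n) → Submodule K M}
    (hU : ∀ A, ∀ j ∉ A, ∀ m ∈ U A, (X j : MvPolynomial (Fin n) K) • m ∈ U (insert j A))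
    (j : Fin n) (a : Fin n →₀ ℕ) (m : M) (hm : m ∈ inflate U a) :
    (X j : MvPolynomial (Fin n) K) • m ∈ inflate U (a + Finsupp.single j 1) := by
  obtain ⟨u, hu, rfl⟩ := mem_inflate.mp hm
  rw [mem_inflate, support_add_single]
  by_cases hj : j ∈ a.support
  · rw [Finset.insert_eq_of_mem hj, excess_add_of_mem hj]
    exact ⟨u, hu, monomial_add_single_smul _ _ _⟩
  · rw [excess_add_of_notMem hj]
    exact ⟨_, hU _ j hj u hu, smul_comm _ _ _⟩

variable {𝓜 : (Fin n →₀ ℕ) → Submodule K M}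

theorem inflate_le [IsMultigraded 𝓜] {U : Finset (Fin n) → Submodule K M}
    (hU : ∀ A, U A ≤ 𝓜 (ind A)) (a : Fin n →₀ ℕ) : inflate U a ≤ 𝓜 a := by
  rintro _ ⟨u, hu, rfl⟩
  have := monomial_smul_mem (hU _ hu) (excess a)
  rwa [ind_support_add_excess] at this

/-- The squarefree submodule whose components of squarefree degree are the `U A`. -/
def inflateSubmodule (U : Finset (Fin n) → Submodule K M)
    (hU : ∀ A, ∀ j ∉ A, ∀ m ∈ U A, (X j : MvPolynomial (Fin n) K) • m ∈ U (insert j A)) :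
    Submodule (MvPolynomial (Fin n) K) M :=
  ofComponents (inflate U) (X_smul_mem_inflate hU)

section

variable {U V : Finset (Fin n) → Submodule K M}
  {hU : ∀ A, ∀ j ∉ A, ∀ m ∈ U A, (X j : MvPolynomial (Fin n) K) • m ∈ U (insert j A)}
  {hV : ∀ A, ∀ j ∉ A, ∀ m ∈ V A, (X j : MvPolynomial (Fin n) K) • m ∈ V (insert j A)}

theorem mem_inflateSubmodule_of_mem {a : Fin n →₀ ℕ} {m : M} (h : m ∈ inflate U a) :
    m ∈ inflateSubmodule U hU :=
  Submodule.mem_iSup_of_mem a h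

theorem mem_inflateSubmodule_of_mem' {A : Finset (Fin n)} {m : M} (h : m ∈ U A) :
    m ∈ inflateSubmodule U hU :=
  mem_inflateSubmodule_of_mem (a := ind A) (by rwa [inflate_ind])

theorem inflateSubmodule_mono (h : ∀ A, U A ≤ V A) :
    inflateSubmodule U hU ≤ inflateSubmodule V hV := by
  have h' : ⨆ a, inflate U a ≤ ⨆ a, inflate V a := iSup_mono fun a => Submodule.map_mono (h _)
  exact h'

variable [IsSquarefreeModule 𝓜]

theorem mem_inflate_of_mem_inflateSubmodule (hle : ∀ A, U A ≤ 𝓜 (ind A)) {a : Fin n →₀ ℕ} {m : M}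
    (hm : m ∈ inflateSubmodule U hU) (ha : m ∈ 𝓜 a) : m ∈ inflate U a :=
  mem_of_mem_iSup (inflate_le hle) hm ha

theorem isSquarefreeSubmodule_inflateSubmodule (hle : ∀ A, U A ≤ 𝓜 (ind A)) :
    IsSquarefreeSubmodule 𝓜 (inflateSubmodule U hU) where
  __ := isMultigraded_ofComponents (inflate_le hle) (X_smul_mem_inflate hU)
  finite := by
    have : Module.Finite (MvPolynomial (Fin n) K) M := IsSquarefreeModule.finite 𝓜
    infer_instance
  bijOn a i hi := by
    have hbij := IsSquarefreeModule.bijOn (𝓜 := 𝓜) a i hi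
    refine ⟨fun m hm => hbij.mapsTo hm, fun m hm m' hm' h => ?_, ?_⟩
    · exact Subtype.ext (hbij.injOn hm hm' (congrArg Subtype.val h))
    · rintro ⟨m, hm⟩ hm'
      obtain ⟨u, hu, rfl⟩ := mem_inflate.mp (mem_inflate_of_mem_inflateSubmodule hle hm hm')
      rw [support_add_single, Finset.insert_eq_of_mem hi] at hu
      have h1 : (monomial (excess a) 1 : MvPolynomial (Fin n) K) • u ∈ inflate U a := ⟨u, hu, rfl⟩
      refine ⟨⟨_, mem_inflateSubmodule_of_mem h1⟩, inflate_le hle a h1, Subtype.ext ?_⟩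
      refine (monomial_add_single_smul (excess a) i u).symm.trans ?_
      rw [← excess_add_of_mem hi]

/-! ### The quotients of a cube chain -/

/-- The data of `CubeChain` for one step `U ≤ V` of the chain. -/
structure CubeStep (F G : Finset (Fin n)) (U V : Finset (Fin n) → Submodule K M) : Prop where
  disjoint : Disjoint F G
  line : ∀ A, G ⊆ A → Disjoint F A → IsLineOver (U A) (V A)
  le_of_not : ∀ A, ¬(G ⊆ A ∧ Disjoint F A) → V A ≤ U A
  mem_of_X_smul_mem : ∀ A, ∀ j ∉ A, G ⊆ A → Disjoint F (insert j A) → ∀ m ∈ V A,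
    (X j : MvPolynomial (Fin n) K) • m ∈ U (insert j A) → m ∈ U A

variable {F G : Finset (Fin n)}

omit [IsScalarTower K (MvPolynomial (Fin n) K) M] in
/-- The squarefree multiples of the generator `w` of degree `G` span the lines in the degrees
`D ∪ G` of the interval. -/
theorem CubeStep.ind_smul_mem (h : CubeStep F G U V)
    (hV : ∀ A, ∀ j ∉ A, ∀ m ∈ V A, (X j : MvPolynomial (Fin n) K) • m ∈ V (insert j A))
    {w : M} (hw : w ∈ V G) (hw' : w ∉ U G) (D : Finset (Fin n)) (hDG : Disjoint D G)
    (hDF : Disjoint F D) :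
    (monomial (ind D) 1 : MvPolynomial (Fin n) K) • w ∈ V (D ∪ G) ∧
      (monomial (ind D) 1 : MvPolynomial (Fin n) K) • w ∉ U (D ∪ G) := by
  induction D using Finset.induction_on with
  | empty => simpa [ind] using ⟨hw, hw'⟩
  | insert j D hj ih =>
    rw [Finset.disjoint_insert_left] at hDG
    have hDF' := hDF
    rw [Finset.disjoint_insert_right] at hDF'
    obtain ⟨h1, h2⟩ := ih hDG.2 hDF'.2
    have hj' : j ∉ D ∪ G := by simp [hj, hDG.1]
    rw [ind_insert hj, monomial_add_single_smul, Finset.insert_union]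
    refine ⟨hV _ j hj' _ h1, fun h3 => h2 ?_⟩
    refine h.mem_of_X_smul_mem _ j hj' Finset.subset_union_right ?_ _ h1 h3
    rw [← Finset.insert_union]
    exact Finset.disjoint_union_right.mpr ⟨hDF, h.disjoint⟩

/-- Monomials outside `P_F` do not annihilate the generator modulo the smaller submodule. -/
theorem CubeStep.monomial_smul_notMem (h : CubeStep F G U V)
    (hleU : ∀ A, U A ≤ 𝓜 (ind A)) (hleV : ∀ A, V A ≤ 𝓜 (ind A))
    (hV : ∀ A, ∀ j ∉ A, ∀ m ∈ V A, (X j : MvPolynomial (Fin n) K) • m ∈ V (insert j A))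
    {w : M} (hw : w ∈ V G) (hw' : w ∉ U G) (b : Fin n →₀ ℕ) (hb : Disjoint F b.support) :
    (monomial b 1 : MvPolynomial (Fin n) K) • w ∉ inflate U (b + ind G) := by
  have hs : (b + ind G).support = b.support \ G ∪ G := by
    ext i
    by_cases hi : i ∈ G <;> simp [ind_apply, hi]
  have hb' : b = ind (b.support \ G) + excess (b + ind G) := by
    apply add_right_cancel (b := ind G)
    rw [add_right_comm, ← Finset.union_sdiff_right, ind_sdiff_add Finset.subset_union_right,
      ← Finset.sdiff_union_self_eq_union, ← hs, ind_support_add_excess]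
  obtain ⟨h1, h2⟩ := h.ind_smul_mem hV hw hw' (b.support \ G) Finset.sdiff_disjoint
    (hb.mono_right Finset.sdiff_subset)
  have h3 : (monomial b 1 : MvPolynomial (Fin n) K) • w =
      (monomial (excess (b + ind G)) 1 : MvPolynomial (Fin n) K) •
        (monomial (ind (b.support \ G)) 1 : MvPolynomial (Fin n) K) • w := by
    rw [smul_smul, monomial_mul, one_mul, add_comm, ← hb']
  rw [h3]
  rintro ⟨u, hu, hu'⟩
  refine h2 ?_
  rw [← hs] at h1 ⊢
  rwa [← (excess_smul_bijOn (IsSquarefreeModule.bijOn (𝓜 := 𝓜)) (b + ind G)).injOn (hleU _ hu)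
    (hleV _ h1) hu']

/-- Elements of degree `a` are multiples of the generator of degree `G`, modulo the smaller
submodule. -/
theorem CubeStep.exists_sub_smul_mem (h : CubeStep F G U V)
    (hV : ∀ A, ∀ j ∉ A, ∀ m ∈ V A, (X j : MvPolynomial (Fin n) K) • m ∈ V (insert j A))
    (hU : ∀ A, ∀ j ∉ A, ∀ m ∈ U A, (X j : MvPolynomial (Fin n) K) • m ∈ U (insert j A))
    {w : M} (hw : w ∈ V G) (hw' : w ∉ U G) {a : Fin n →₀ ℕ} {m : M} (hm : m ∈ inflate V a) :
    ∃ f : MvPolynomial (Fin n) K,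
      Ideal.Quotient.mk (primeIdeal K F) f ∈ primeQuotientGrading K F G a ∧
      m - f • w ∈ inflateSubmodule U hU := by
  obtain ⟨u, hu, rfl⟩ := mem_inflate.mp hm
  by_cases hA : G ⊆ a.support ∧ Disjoint F a.support
  · obtain ⟨h1, h2⟩ := h.ind_smul_mem hV hw hw' (a.support \ G) Finset.sdiff_disjoint
      (hA.2.mono_right Finset.sdiff_subset)
    rw [Finset.sdiff_union_of_subset hA.1] at h1 h2
    obtain ⟨c, hc⟩ := (h.line _ hA.1 hA.2).exists_sub_smul_mem h1 h2 hu
    refine ⟨c • monomial (excess a + ind (a.support \ G)) 1, ?_, ?_⟩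
    · have h3 : excess a + ind (a.support \ G) + ind G = a := by
        rw [add_assoc, ind_sdiff_add hA.1, add_comm, ind_support_add_excess]
      have h4 := (mem_primeQuotientGrading_iff (K := K) (F := F) (G := G)).mpr
        ⟨c, (rfl : _ = c • Ideal.Quotient.mk (primeIdeal K F)
          (monomial (excess a + ind (a.support \ G)) 1))⟩
      rwa [h3] at h4
    · have h3 : (c • monomial (excess a + ind (a.support \ G)) 1 : MvPolynomial (Fin n) K) • w =
          (monomial (excess a) 1 : MvPolynomial (Fin n) K) •
            c • (monomial (ind (a.support \ G)) 1 : MvPolynomial (Fin n) K) • w := by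
        rw [smul_assoc, smul_comm _ c, smul_smul, monomial_mul, one_mul]
      rw [h3, ← smul_sub]
      exact Submodule.smul_mem _ _ (mem_inflateSubmodule_of_mem' hc)
  · refine ⟨0, ?_, ?_⟩
    · rw [map_zero]; exact zero_mem _
    · rw [zero_smul, sub_zero]
      exact Submodule.smul_mem _ _ (mem_inflateSubmodule_of_mem' (h.le_of_not _ hA hu))

theorem proj_smul_eq {a : Fin n →₀ ℕ} {w : M} (hw : w ∈ 𝓜 a) (f : MvPolynomial (Fin n) K)
    (b : Fin n →₀ ℕ) :
    (proj 𝓜 (b + a) (f • w) : M) = f.coeff b • (monomial b 1 : MvPolynomial (Fin n) K) • w := by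
  induction f using MvPolynomial.induction_on' with
  | monomial d c =>
    have h1 : (monomial d c : MvPolynomial (Fin n) K) • w =
        c • (monomial d 1 : MvPolynomial (Fin n) K) • w := by
      rw [← smul_assoc, smul_monomial, smul_eq_mul, mul_one]
    have h2 := monomial_smul_mem hw d
    rw [add_comm] at h2
    classical
    rw [h1, map_smul, coeff_monomial]
    split_ifs with h
    · subst h
      rw [Submodule.coe_smul, proj_of_mem h2]
    · rw [proj_of_mem_ne h2 (fun h' => h (add_right_cancel h')), smul_zero, zero_smul]
      rfl
  | add p q hp hq =>
    rw [add_smul, map_add, Submodule.coe_add, hp, hq, coeff_add, add_smul]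

/-- The annihilator of the generator modulo the smaller submodule is `P_F`. -/
theorem CubeStep.smul_mem_iff (h : CubeStep F G U V)
    (hleU : ∀ A, U A ≤ 𝓜 (ind A)) (hleV : ∀ A, V A ≤ 𝓜 (ind A))
    (hV : ∀ A, ∀ j ∉ A, ∀ m ∈ V A, (X j : MvPolynomial (Fin n) K) • m ∈ V (insert j A))
    (hU : ∀ A, ∀ j ∉ A, ∀ m ∈ U A, (X j : MvPolynomial (Fin n) K) • m ∈ U (insert j A))
    {w : M} (hw : w ∈ V G) (hw' : w ∉ U G) (f : MvPolynomial (Fin n) K) :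
    f • w ∈ inflateSubmodule U hU ↔ f ∈ primeIdeal K F := by
  constructor
  · intro hf
    rw [primeIdeal, mem_ideal_span_X_image]
    intro b hb
    by_contra! hbF
    refine h.monomial_smul_notMem hleU hleV hV hw hw' b ?_ ?_
    · rw [Finset.disjoint_left]
      intro i hi
      simpa using hbF i hi
    · have h1 := proj_mem_of_mem_iSup (inflate_le hleU) hf (b + ind G)
      rw [proj_smul_eq (hleV _ hw)] at h1
      exact (Submodule.smul_mem_iff _ (mem_support_iff.mp hb)).mp h1
  · intro hf
    have h1 : primeIdeal K F ≤
        (inflateSubmodule U hU).comap (LinearMap.toSpanSingleton (MvPolynomial (Fin n) K) M w) := by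
      rw [primeIdeal, Ideal.span_le]
      rintro _ ⟨j, hj, rfl⟩
      have hj' : j ∉ G := Finset.disjoint_left.mp h.disjoint hj
      refine mem_inflateSubmodule_of_mem' (hU := hU) (h.le_of_not (insert j G) (fun hA => ?_)
        (hV G j hj' w hw))
      exact Finset.disjoint_left.mp hA.2 hj (Finset.mem_insert_self _ _)
    exact h1 hf

/-- The class of an element of `V G` outside `U G` generates the quotient and has annihilator
`P_F`. -/
theorem CubeStep.gradedIso (h : CubeStep F G U V)
    (hleU : ∀ A, U A ≤ 𝓜 (ind A)) (hleV : ∀ A, V A ≤ 𝓜 (ind A))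
    (hV : ∀ A, ∀ j ∉ A, ∀ m ∈ V A, (X j : MvPolynomial (Fin n) K) • m ∈ V (insert j A))
    (hU : ∀ A, ∀ j ∉ A, ∀ m ∈ U A, (X j : MvPolynomial (Fin n) K) • m ∈ U (insert j A)) :
    GradedIso (quotientGrading (submoduleGrading 𝓜 (inflateSubmodule V hV))
        ((inflateSubmodule U hU).submoduleOf (inflateSubmodule V hV)))
      (primeQuotientGrading K F G) := by
  obtain ⟨w, hw, hw', -⟩ := h.line G subset_rfl h.disjoint
  set L := inflateSubmodule U hU
  set L' := inflateSubmodule V hV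
  have hwL : w ∈ L' := mem_inflateSubmodule_of_mem' hw
  let p : MvPolynomial (Fin n) K →ₗ[MvPolynomial (Fin n) K] (L' ⧸ L.submoduleOf L') :=
    (L.submoduleOf L').mkQ ∘ₗ LinearMap.toSpanSingleton (MvPolynomial (Fin n) K) L' ⟨w, hwL⟩
  have hp : ∀ (f : MvPolynomial (Fin n) K) (m : L'), p f = (L.submoduleOf L').mkQ m ↔
      (m : M) - f • w ∈ L := fun f m => eq_comm.trans (Submodule.Quotient.eq _)
  have hker : LinearMap.ker p = primeIdeal K F := by
    ext f
    rw [← h.smul_mem_iff hleU hleV hV hU hw hw' f, LinearMap.mem_ker, ← map_zero (Submodule.mkQ _),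
      hp, ZeroMemClass.coe_zero, zero_sub, neg_mem_iff]
  have hsurj : Function.Surjective p := by
    intro x
    obtain ⟨⟨m, hm⟩, rfl⟩ := Submodule.mkQ_surjective _ x
    suffices h' : ∀ m ∈ ⨆ a, inflate V a, ∃ f : MvPolynomial (Fin n) K, m - f • w ∈ L by
      obtain ⟨f, hf⟩ := h' m hm
      exact ⟨f, (hp f ⟨m, hm⟩).mpr hf⟩
    intro m hm
    induction hm using Submodule.iSup_induction' with
    | mem a m hm =>
      obtain ⟨f, -, hf⟩ := h.exists_sub_smul_mem hV hU hw hw' hm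
      exact ⟨f, hf⟩
    | zero => exact ⟨0, by simp⟩
    | add m m' _ _ ih ih' =>
      obtain ⟨f, hf⟩ := ih
      obtain ⟨f', hf'⟩ := ih'
      refine ⟨f + f', ?_⟩
      rw [add_smul, add_sub_add_comm]
      exact add_mem hf hf'
  let φ : (MvPolynomial (Fin n) K ⧸ primeIdeal K F) ≃ₗ[MvPolynomial (Fin n) K]
      (L' ⧸ L.submoduleOf L') :=
    (Submodule.quotEquivOfEq _ _ hker.symm).trans (p.quotKerEquivOfSurjective hsurj)
  have hφ : ∀ f, φ (Ideal.Quotient.mk _ f) = p f := fun f => rfl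
  refine ⟨φ.symm, fun a x => ⟨?_, fun hx => ?_⟩⟩
  · rintro ⟨m, hm, rfl⟩
    obtain ⟨f, hf, hf'⟩ := h.exists_sub_smul_mem hV hU hw hw'
      (mem_inflate_of_mem_inflateSubmodule hleV m.2 hm)
    have h1 : φ.symm ((L.submoduleOf L').mkQ m) = Ideal.Quotient.mk _ f := by
      rw [LinearEquiv.symm_apply_eq, hφ]
      exact ((hp f m).mpr hf').symm
    exact h1 ▸ hf
  · have h1 : primeQuotientGrading K F G a ≤
        (quotientGrading (submoduleGrading 𝓜 L') (L.submoduleOf L') a).comap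
          (φ.toLinearMap.restrictScalars K) := by
      rw [primeQuotientGrading, Submodule.span_le]
      rintro _ ⟨b, rfl, rfl⟩
      refine ⟨(monomial b 1 : MvPolynomial (Fin n) K) • ⟨w, hwL⟩, ?_, rfl⟩
      have := monomial_smul_mem (hleV _ hw) b
      rwa [add_comm] at this
    have h2 := h1 hx
    simpa using h2

end

theorem CubeChain.hasPrimeChain [IsSquarefreeModule 𝓜] {r : ℕ} {F G : Fin r → Finset (Fin n)}
    {U : Fin (r + 1) → Finset (Fin n) → Submodule K M} (h : CubeChain 𝓜 F G U) :
    HasPrimeChain 𝓜 F G := by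
  refine ⟨fun i => inflateSubmodule (U i) (h.X_smul_mem i), fun i j hij => ?_, ?_, ?_, fun i => ?_,
    fun i => ?_⟩
  · exact inflateSubmodule_mono fun A => h.mono A hij
  · rw [eq_bot_iff]
    have h1 : ⨆ a, inflate (U 0) a ≤ ⊥ := iSup_le fun a => by
      rw [inflate, h.zero_eq, Submodule.map_bot]
    exact h1
  · rw [eq_top_iff]
    have h1 : ⊤ ≤ ⨆ a, inflate (U (Fin.last r)) a := by
      rw [← iSup_grading 𝓜]
      refine iSup_mono fun a m hm => ?_
      obtain ⟨u, hu, rfl⟩ :=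
        (excess_smul_bijOn (IsSquarefreeModule.bijOn (𝓜 := 𝓜)) a).surjOn hm
      exact ⟨u, by rwa [h.last_eq], rfl⟩
    exact fun m _ => h1 (Submodule.mem_top (x := m))
  · exact isSquarefreeSubmodule_inflateSubmodule (h.le_grading i)
  · exact CubeStep.gradedIso ⟨h.disjoint i, h.line i, h.le_of_not i, h.mem_of_X_smul_mem i⟩
      (h.le_grading _) (h.le_grading _) _ _

end Inflate

/-! ### Duality of cube chains -/

section Duality

open MvPolynomial

variable {K : Type u} [Field K] {n : ℕ} {M : Type*} [AddCommGroup M] [Module K M]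
  [Module (MvPolynomial (Fin n) K) M] {M' : Type*} [AddCommGroup M'] [Module K M']
  [Module (MvPolynomial (Fin n) K) M']

/-- A bilinear form that puts the components of complementary squarefree degrees of two multigraded
modules in duality, and for which `⟨x_j v, w⟩` and `⟨v, x_j w⟩` vanish simultaneously. The latter
is all that remains of adjointness up to sign when only annihilators of subspaces matter. -/
structure IsComplementPairing (𝓜 : (Fin n →₀ ℕ) → Submodule K M)
    (𝓜' : (Fin n →₀ ℕ) → Submodule K M') (b : M →ₗ[K] M' →ₗ[K] K) : Prop where
  eq_zero_left : ∀ A, ∀ v ∈ 𝓜 (ind A), (∀ w ∈ 𝓜' (ind Aᶜ), b v w = 0) → v = 0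
  eq_zero_right : ∀ A, ∀ w ∈ 𝓜' (ind Aᶜ), (∀ v ∈ 𝓜 (ind A), b v w = 0) → w = 0
  adjoint : ∀ A, ∀ j ∉ A, ∀ v ∈ 𝓜 (ind A), ∀ w ∈ 𝓜' (ind (insert j A)ᶜ),
    (b ((X j : MvPolynomial (Fin n) K) • v) w = 0 ↔
      b v ((X j : MvPolynomial (Fin n) K) • w) = 0)

variable {𝓜 : (Fin n →₀ ℕ) → Submodule K M} {𝓜' : (Fin n →₀ ℕ) → Submodule K M'}
  {b : M →ₗ[K] M' →ₗ[K] K}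

theorem IsComplementPairing.flip (h : IsComplementPairing 𝓜 𝓜' b) :
    IsComplementPairing 𝓜' 𝓜 b.flip where
  eq_zero_left A v hv hw := h.eq_zero_right Aᶜ v (by rwa [compl_compl]) hw
  eq_zero_right A w hw hv := h.eq_zero_left Aᶜ w hw (by rwa [compl_compl])
  adjoint A j hj v hv w hw := by
    have h1 : insert j (insert j A)ᶜ = Aᶜ := Finset.insert_compl_insert hj
    refine (h.adjoint (insert j A)ᶜ j (by simp) w hw v ?_).symm
    rwa [h1, compl_compl]

theorem IsComplementPairing.finiteDimensional (h : IsComplementPairing 𝓜 𝓜' b)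
    (hfin : ∀ A, FiniteDimensional K (𝓜 (ind A))) (A : Finset (Fin n)) :
    FiniteDimensional K (𝓜' (ind A)) := by
  have := hfin Aᶜ
  refine FiniteDimensional.of_injective ((b.domRestrict₁₂ (𝓜 (ind Aᶜ)) (𝓜' (ind A))).flip)
    ((injective_iff_map_eq_zero _).mpr fun w hw => Subtype.ext ?_)
  refine h.eq_zero_right Aᶜ w (by rw [compl_compl]; exact w.2) fun v hv => ?_
  exact LinearMap.congr_fun hw ⟨v, hv⟩

/-- The elements outside a subspace of `M_A` are separated from it by the dual component. -/
theorem IsComplementPairing.exists_ne_zero (h : IsComplementPairing 𝓜 𝓜' b) {A : Finset (Fin n)}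
    [FiniteDimensional K (𝓜 (ind A))] {U : Submodule K M} {v : M}
    (hv : v ∈ 𝓜 (ind A)) (hvU : v ∉ U) :
    ∃ w ∈ 𝓜' (ind Aᶜ), (∀ u ∈ U ⊓ 𝓜 (ind A), b u w = 0) ∧ b v w ≠ 0 := by
  let p := b.domRestrict₁₂ (𝓜 (ind A)) (𝓜' (ind Aᶜ))
  have hp : p.IsPerfPair := by
    refine .of_injective ((injective_iff_map_eq_zero _).mpr fun v hv => Subtype.ext ?_)
      ((injective_iff_map_eq_zero _).mpr fun w hw => Subtype.ext ?_)
    · exact h.eq_zero_left A v v.2 fun w hw => LinearMap.congr_fun hv ⟨w, hw⟩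
    · exact h.eq_zero_right A w w.2 fun v hv => LinearMap.congr_fun hw ⟨v, hv⟩
  obtain ⟨l, hl, hU⟩ := Submodule.exists_le_ker_of_notMem hvU
  obtain ⟨w, hw⟩ := hp.bijective_right.2 (l ∘ₗ (𝓜 (ind A)).subtype)
  have hw' : ∀ u (hu : u ∈ 𝓜 (ind A)), b u w = l u := fun u hu => LinearMap.congr_fun hw ⟨u, hu⟩
  refine ⟨w, w.2, fun u hu => ?_, ?_⟩
  · rw [hw' u hu.2]
    exact hU hu.1
  · rwa [hw' v hv]

/-- The annihilator in `M'_A` of a subspace of `M_{Aᶜ}`. -/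
def annihilator (𝓜' : (Fin n →₀ ℕ) → Submodule K M') (b : M →ₗ[K] M' →ₗ[K] K)
    (U : Finset (Fin n) → Submodule K M) (A : Finset (Fin n)) : Submodule K M' :=
  𝓜' (ind A) ⊓ ⨅ u ∈ U Aᶜ, LinearMap.ker (b u)

omit [Module (MvPolynomial (Fin n) K) M] [Module (MvPolynomial (Fin n) K) M'] in
theorem mem_annihilator {U : Finset (Fin n) → Submodule K M} {A : Finset (Fin n)} {w : M'} :
    w ∈ annihilator 𝓜' b U A ↔ w ∈ 𝓜' (ind A) ∧ ∀ u ∈ U Aᶜ, b u w = 0 := by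
  simp [annihilator]

/-- The annihilators of a cube chain, in reverse order, form a cube chain of the dual, with `F` and
`G` exchanged. -/
theorem CubeChain.annihilator [IsMultigraded 𝓜'] (hb : IsComplementPairing 𝓜 𝓜' b)
    (hfin : ∀ A, FiniteDimensional K (𝓜 (ind A))) {r : ℕ} {F G : Fin r → Finset (Fin n)}
    {U : Fin (r + 1) → Finset (Fin n) → Submodule K M} (h : CubeChain 𝓜 F G U) :
    CubeChain 𝓜' (fun i => G i.rev) (fun i => F i.rev)
      (fun i => SqfreeDual.annihilator 𝓜' b (U i.rev)) where
  le_grading i A := inf_le_left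
  mono A i j hij w hw := by
    rw [mem_annihilator] at hw ⊢
    exact ⟨hw.1, fun u hu => hw.2 u (h.mono _ (Fin.rev_le_rev.mpr hij) hu)⟩
  zero_eq A := by
    rw [eq_bot_iff]
    intro w hw
    rw [mem_annihilator, Fin.rev_zero, h.last_eq] at hw
    exact hb.eq_zero_right Aᶜ w (by rw [compl_compl]; exact hw.1) hw.2
  last_eq A := by
    ext w
    rw [mem_annihilator, Fin.rev_last, h.zero_eq]
    simp
  X_smul_mem i A j hj w hw := by
    rw [mem_annihilator] at hw ⊢
    have h1 : insert j (insert j A)ᶜ = Aᶜ := Finset.insert_compl_insert hj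
    refine ⟨?_, fun u hu => ?_⟩
    · rw [ind_insert hj]
      exact IsMultigraded.X_smul_mem j _ w hw.1
    · refine (hb.adjoint (insert j A)ᶜ j (by simp) u (h.le_grading _ _ hu) w ?_).mp ?_
      · rw [h1, compl_compl]
        exact hw.1
      · refine hw.2 _ ?_
        rw [← h1]
        exact h.X_smul_mem _ _ j (by simp) u hu
  disjoint i := (h.disjoint _).symm
  line i A hFA hGA := by
    rw [Fin.rev_castSucc, Fin.rev_succ]
    obtain ⟨v, hv, hvU, hline⟩ := h.line i.rev Aᶜ
      (fun x hx => Finset.mem_compl.mpr (Finset.disjoint_left.mp hGA hx))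
      (Finset.disjoint_left.mpr fun x hx => by simpa using hFA hx)
    have := hfin Aᶜ
    have hle := h.le_grading
    obtain ⟨w, hw, hwU, hvw⟩ := hb.exists_ne_zero (hle _ _ hv) hvU
    rw [compl_compl] at hw
    have hwU' : ∀ u ∈ U i.rev.castSucc Aᶜ, b u w = 0 := fun u hu => hwU u ⟨hu, hle _ _ hu⟩
    refine ⟨w, mem_annihilator.mpr ⟨hw, hwU'⟩, fun hw' => hvw ((mem_annihilator.mp hw').2 v hv),
      fun w' hw' => ?_⟩
    rw [mem_annihilator] at hw'
    refine ⟨b v w' / b v w, mem_annihilator.mpr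
      ⟨sub_mem hw'.1 (Submodule.smul_mem _ _ hw), fun u hu => ?_⟩⟩
    obtain ⟨c, hc⟩ := hline u hu
    -- `u = (u - c • v) + c • v`, and the functional vanishes on both summands.
    have h1 : ∀ y, (∀ u ∈ U i.rev.castSucc Aᶜ, b u y = 0) → b u y = c * b v y := by
      intro y hy
      have := hy _ hc
      rwa [map_sub, map_smul, LinearMap.sub_apply, LinearMap.smul_apply, smul_eq_mul,
        sub_eq_zero] at this
    rw [map_sub, map_smul, h1 w' hw'.2, h1 w hwU', smul_eq_mul]
    field_simp
    ring
  le_of_not i A hA w hw := by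
    rw [Fin.rev_succ, mem_annihilator] at hw
    rw [Fin.rev_castSucc, mem_annihilator]
    refine ⟨hw.1, fun u hu => hw.2 u (h.le_of_not _ _ (fun h' => hA ⟨?_, ?_⟩) hu)⟩
    · exact fun x hx => by simpa using Finset.disjoint_left.mp h'.2 hx
    · exact Finset.disjoint_left.mpr fun x hx => by simpa using h'.1 hx
  mem_of_X_smul_mem i A j hj hFA hGA w hw hXw := by
    rw [Fin.rev_succ, mem_annihilator] at hw
    rw [Fin.rev_castSucc, mem_annihilator] at hXw ⊢
    have h1 : insert j (insert j A)ᶜ = Aᶜ := Finset.insert_compl_insert hj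
    have hj' : j ∉ (insert j A)ᶜ := by simp
    have hG : G i.rev ⊆ (insert j A)ᶜ :=
      fun x hx => Finset.mem_compl.mpr (Finset.disjoint_left.mp hGA hx)
    have hF : Disjoint (F i.rev) Aᶜ :=
      Finset.disjoint_left.mpr fun x hx => by simpa using hFA hx
    refine ⟨hw.1, fun u hu => ?_⟩
    -- Multiplication by `x_j` maps the line in degree `(insert j A)ᶜ` onto the one in degree `Aᶜ`.
    obtain ⟨v, hv, hvU, -⟩ := h.line i.rev (insert j A)ᶜ hG
      (hF.mono_right (Finset.compl_subset_compl.mpr (Finset.subset_insert j A)))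
    have hXv := h.X_smul_mem _ _ j hj' v hv
    have hXvU : (X j : MvPolynomial (Fin n) K) • v ∉ U i.rev.castSucc (insert j (insert j A)ᶜ) :=
      fun h' => hvU (h.mem_of_X_smul_mem _ _ j hj' hG (by rwa [h1]) v hv h')
    rw [h1] at hXv hXvU
    obtain ⟨c, hc⟩ := (h.line i.rev Aᶜ (hG.trans
      (Finset.compl_subset_compl.mpr (Finset.subset_insert j A))) hF).exists_sub_smul_mem
      hXv hXvU hu
    have h2 : b ((X j : MvPolynomial (Fin n) K) • v) w = 0 := by
      refine (hb.adjoint (insert j A)ᶜ j hj' v (h.le_grading _ _ hv) w ?_).mpr (hXw.2 v hv)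
      rw [h1, compl_compl]
      exact hw.1
    have h3 := hw.2 _ hc
    rwa [map_sub, map_smul, LinearMap.sub_apply, LinearMap.smul_apply, h2, smul_zero,
      sub_zero] at h3

variable [IsScalarTower K (MvPolynomial (Fin n) K) M]
  [IsScalarTower K (MvPolynomial (Fin n) K) M']

theorem HasPrimeChain.dual [IsSquarefreeModule 𝓜] [IsSquarefreeModule 𝓜']
    (hb : IsComplementPairing 𝓜 𝓜' b) {r : ℕ} {F G : Fin r → Finset (Fin n)}
    (h : HasPrimeChain 𝓜 F G) : HasPrimeChain 𝓜' (fun i => G i.rev) (fun i => F i.rev) := by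
  have : Module.Finite (MvPolynomial (Fin n) K) M := IsSquarefreeModule.finite 𝓜
  obtain ⟨U, hU⟩ := h.exists_cubeChain
  exact (hU.annihilator hb fun A => finiteDimensional_component 𝓜 _).hasPrimeChain

theorem hasPrimeChain_iff_of_pairing [IsSquarefreeModule 𝓜] [IsSquarefreeModule 𝓜']
    (hb : IsComplementPairing 𝓜 𝓜' b) {r : ℕ} {F G : Fin r → Finset (Fin n)} :
    HasPrimeChain 𝓜 F G ↔ HasPrimeChain 𝓜' (fun i => G i.rev) (fun i => F i.rev) := by
  refine ⟨fun h => h.dual hb, fun h => ?_⟩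
  simpa using h.dual hb.flip

end Duality

/-! ### The monomial basis of the exterior algebra -/

section Exterior

variable (K : Type u) [Field K] {n : ℕ}

/-- The monomial `e_C`, the product of the `e_j`, `j ∈ C`, in increasing order. -/
def eProd (C : Finset (Fin n)) : Ext K n := ((C.sort (· ≤ ·)).map (e K)).prod

theorem e_mul_prod_of_notMem (j : Fin n) (l : List (Fin n)) (hl : l.Pairwise (· ≤ ·))
    (hj : j ∉ l) :
    e K j * (l.map (e K)).prod =
      (-1 : K) ^ (l.filter (· < j)).length • ((l.orderedInsert (· ≤ ·) j).map (e K)).prod := by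
  induction l with
  | nil => simp
  | cons k t ih =>
    rw [List.mem_cons, not_or] at hj
    by_cases hjk : j ≤ k
    · have h1 : (k :: t).filter (· < j) = [] := by
        rw [List.filter_eq_nil_iff]
        intro i hi
        have : k ≤ i := by
          rcases List.mem_cons.mp hi with rfl | hi
          exacts [le_rfl, List.rel_of_pairwise_cons hl hi]
        simpa using hjk.trans this
      rw [h1, List.orderedInsert_cons_of_le _ _ hjk]
      simp
    · rw [List.orderedInsert_of_not_le _ _ hjk,
        List.filter_cons_of_pos (by simpa using hjk), List.map_cons, List.prod_cons, ← mul_assoc,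
        e_mul_comm, neg_mul, mul_assoc, ih hl.of_cons hj.2, List.map_cons, List.prod_cons,
        mul_smul_comm, List.length_cons, pow_succ, mul_neg_one, neg_smul]

theorem e_mul_eProd_of_notMem {C : Finset (Fin n)} {j : Fin n} (hj : j ∉ C) :
    e K j * eProd K C = (-1 : K) ^ below C j • eProd K (insert j C) := by
  have h1 : (C.sort (· ≤ ·)).orderedInsert (· ≤ ·) j = (insert j C).sort (· ≤ ·) := by
    refine List.Perm.eq_of_pairwise (le := (· ≤ ·)) (fun a b _ _ => le_antisymm)
      ((Finset.pairwise_sort _ _).orderedInsert _ _) (Finset.pairwise_sort _ _) ?_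
    refine (List.perm_orderedInsert _ _ _).trans ?_
    rw [List.perm_ext_iff_of_nodup _ (Finset.sort_nodup _ _)]
    · simp
    · simp [hj]
  have h2 : ((C.sort (· ≤ ·)).filter (· < j)).length = below C j := by
    rw [below, ← List.toFinset_card_of_nodup ((Finset.sort_nodup _ _).filter _)]
    congr 1
    ext i
    simp
  rw [eProd, eProd, e_mul_prod_of_notMem K j _ (Finset.pairwise_sort _ _) (by simpa), h1, h2]

theorem e_mul_eProd_of_mem {C : Finset (Fin n)} {j : Fin n} (hj : j ∈ C) :
    e K j * eProd K C = 0 := by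
  have h := e_mul_eProd_of_notMem K (Finset.notMem_erase j C)
  rw [Finset.insert_erase hj] at h
  have h1 : e K j * (e K j * eProd K (C.erase j)) = 0 := by
    rw [← mul_assoc, e_mul_self, zero_mul]
  rw [h, mul_smul_comm, smul_eq_zero] at h1
  exact h1.resolve_left (by simp)

theorem prod_mul_e (l : List (Fin n)) (j : Fin n) :
    (l.map (e K)).prod * e K j = (-1 : K) ^ l.length • (e K j * (l.map (e K)).prod) := by
  induction l with
  | nil => simp
  | cons k t ih =>
    rw [List.map_cons, List.prod_cons, mul_assoc, ih, mul_smul_comm, ← mul_assoc, ← mul_assoc,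
      e_mul_comm K k j, neg_mul, List.length_cons, pow_succ, mul_neg_one, neg_smul, smul_neg]

theorem eProd_mul_e (C : Finset (Fin n)) (j : Fin n) :
    eProd K C * e K j = (-1 : K) ^ C.card • (e K j * eProd K C) := by
  rw [eProd, prod_mul_e, Finset.length_sort]

/-- The coefficient of `e_1 ⋯ e_n`, given by the determinant. -/
def topCoeff (K : Type u) [Field K] (n : ℕ) : Ext K n →ₗ[K] K :=
  ExteriorAlgebra.liftAlternating fun i =>
    if h : i = n then h ▸ (Matrix.detRowAlternating : (Fin n → K) [⋀^Fin n]→ₗ[K] K) else 0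

theorem topCoeff_eProd_univ : topCoeff K n (eProd K Finset.univ) = 1 := by
  have h : eProd K (Finset.univ : Finset (Fin n)) =
      ExteriorAlgebra.ιMulti K n fun i => Pi.single i 1 := by
    rw [ExteriorAlgebra.ιMulti_apply, eProd, Fin.sort_univ, ← List.ofFn_id, List.map_ofFn]
    rfl
  rw [h, topCoeff, ExteriorAlgebra.liftAlternating_apply_ιMulti, dif_pos rfl]
  refine Eq.trans ?_ (Matrix.det_one (n := Fin n) (R := K))
  refine congrArg Matrix.det (Matrix.ext fun i j => ?_)
  rw [Matrix.one_apply, Pi.single_apply]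
  simp only [eq_comm]

/-- Any `e_C` divides `e_1 ⋯ e_n` up to sign, and the latter has a nonzero top coefficient. -/
theorem eProd_ne_zero (C : Finset (Fin n)) : eProd K C ≠ 0 := by
  intro hC
  have h : ∀ D : Finset (Fin n), Disjoint D C → eProd K (D ∪ C) = 0 := by
    intro D
    induction D using Finset.induction_on with
    | empty => simpa using hC
    | insert j D hj ih =>
      intro hD
      rw [Finset.disjoint_insert_left] at hD
      have h1 := e_mul_eProd_of_notMem K (j := j) (C := D ∪ C) (by simp [hj, hD.1])
      rw [ih hD.2, mul_zero, eq_comm, smul_eq_zero] at h1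
      rw [Finset.insert_union]
      exact h1.resolve_left (by simp)
  have h1 := h Cᶜ disjoint_compl_left
  have h2 := topCoeff_eProd_univ K (n := n)
  rw [← Finset.union_compl C, Finset.union_comm] at h2
  simp [h1] at h2

variable {K}

theorem prod_map_e_eq (l : List (Fin n)) :
    (∃ c : K, (l.map (e K)).prod = c • eProd K l.toFinset) ∧
      (¬ l.Nodup → (l.map (e K)).prod = 0) := by
  induction l with
  | nil => exact ⟨⟨1, by simp [eProd]⟩, by simp⟩
  | cons j t ih =>
    obtain ⟨⟨c, hc⟩, h0⟩ := ih
    rw [List.map_cons, List.prod_cons, List.toFinset_cons]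
    by_cases hj : j ∈ t
    · have : e K j * (t.map (e K)).prod = 0 := by
        rw [hc, mul_smul_comm, e_mul_eProd_of_mem K (by simpa), smul_zero]
      exact ⟨⟨0, by rw [this, zero_smul]⟩, fun _ => this⟩
    · refine ⟨⟨c * (-1) ^ below t.toFinset j, ?_⟩, fun h => ?_⟩
      · rw [hc, mul_smul_comm, e_mul_eProd_of_notMem K (by simpa), smul_smul]
      · rw [h0 (fun h' => h (List.nodup_cons.mpr ⟨hj, h'⟩)), mul_zero]

theorem sum_map_single_apply (l : List (Fin n)) (i : Fin n) :
    (l.map fun j => Finsupp.single j 1).sum i = l.count i := by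
  induction l with
  | nil => simp
  | cons j t ih =>
    rw [List.map_cons, List.sum_cons, Finsupp.add_apply, ih, List.count_cons, Finsupp.single_apply,
      add_comm]
    simp

theorem exists_eq_smul_eProd {C : Finset (Fin n)} {y : Ext K n} (hy : y ∈ extGrading K (ind C)) :
    ∃ c : K, y = c • eProd K C := by
  have h : extGrading K (ind C) ≤ Submodule.span K {eProd K C} := by
    rw [extGrading, Submodule.span_le]
    rintro _ ⟨l, hl, rfl⟩
    have h1 : l.toFinset = C := by
      ext i
      have := DFunLike.congr_fun hl i
      rw [sum_map_single_apply, ind_apply] at this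
      rw [List.mem_toFinset, ← List.count_pos_iff, this]
      split_ifs with hi <;> simp [hi]
    obtain ⟨c, hc⟩ := (prod_map_e_eq (K := K) l).1
    rw [hc, h1]
    exact Submodule.smul_mem _ _ (Submodule.mem_span_singleton_self _)
  obtain ⟨c, hc⟩ := Submodule.mem_span_singleton.mp (h hy)
  exact ⟨c, hc.symm⟩

/-- The exterior algebra vanishes in degrees that are not squarefree. -/
theorem extGrading_add_eq_bot {B C : Finset (Fin n)} (h : ¬ Disjoint B C) :
    extGrading K (ind B + ind C) = ⊥ := by
  rw [extGrading, Submodule.span_eq_bot]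
  rintro _ ⟨l, hl, rfl⟩
  obtain ⟨i, hB, hC⟩ := Finset.not_disjoint_iff.mp h
  refine (prod_map_e_eq l).2 fun hl' => ?_
  have := DFunLike.congr_fun hl i
  rw [sum_map_single_apply, Finsupp.add_apply, ind_apply, ind_apply, if_pos hB, if_pos hC] at this
  have := List.nodup_iff_count_le_one.mp hl' i
  omega

theorem eProd_mem (C : Finset (Fin n)) : eProd K C ∈ extGrading K (ind C) := by
  refine Submodule.subset_span ⟨C.sort (· ≤ ·), ?_, rfl⟩
  ext i
  rw [sum_map_single_apply, ind_apply, (Finset.sort_nodup _ _).count]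
  simp

theorem ind_union {B C : Finset (Fin n)} (h : Disjoint B C) : ind (B ∪ C) = ind B + ind C :=
  Finset.sum_union h

theorem eq_zero_of_e_mul_eq_zero {C : Finset (Fin n)} {j : Fin n} (hj : j ∉ C) {y : Ext K n}
    (hy : y ∈ extGrading K (ind C)) (h : e K j * y = 0) : y = 0 := by
  obtain ⟨c, rfl⟩ := exists_eq_smul_eProd hy
  rw [mul_smul_comm, e_mul_eProd_of_notMem K hj, smul_smul, smul_eq_zero] at h
  have h1 := h.resolve_right (eProd_ne_zero K _)
  rw [(mul_eq_zero.mp h1).resolve_right (by simp), zero_smul]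

/-- Linear maps commuting with the generators `e_j` are linear over the exterior algebra. -/
theorem map_ext_smul {N P : Type*} [AddCommGroup N] [Module K N] [Module (Ext K n) N]
    [IsScalarTower K (Ext K n) N] [AddCommGroup P] [Module K P] [Module (Ext K n) P]
    [IsScalarTower K (Ext K n) P] {f : N →ₗ[K] P} (h : ∀ (j : Fin n) x, f (e K j • x) = e K j • f x)
    (y : Ext K n) (x : N) : f (y • x) = y • f x := by
  induction y using ExteriorAlgebra.induction generalizing x with
  | algebraMap c => rw [algebraMap_smul, algebraMap_smul, map_smul]
  | ι w =>
    have hw : ExteriorAlgebra.ι K w = ∑ j, w j • e K j := by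
      have h1 : w = ∑ j, w j • (Pi.single j 1 : Fin n → K) := by
        ext i
        simp [Pi.single_apply]
      conv_lhs => rw [h1]
      simp only [map_sum, map_smul, e]
    simp only [hw, Finset.sum_smul, map_sum, smul_assoc, map_smul, h]
  | mul a b ha hb => rw [mul_smul, mul_smul, ha, hb]
  | add a b ha hb => rw [add_smul, add_smul, map_add, ha, hb]

end Exterior

/-! ### The functor `𝐆` yields squarefree modules -/

section PolyModule

open MvPolynomial MulOpposite

variable {K : Type u} [Field K] {n : ℕ} {N : Type v} [AddCommGroup N] [Module K N]
  {𝓝 : (Fin n →₀ ℕ) → Submodule K N}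

variable (𝓝) in
/-- The component of degree `a` of an element of `𝐆(N)`, as an element of `N`. -/
def polyComp (a : Fin n →₀ ℕ) : PolyModule 𝓝 →ₗ[K] N :=
  polyLift 𝓝 fun b => if b = a then (𝓝 (ind b.support)).subtype else 0

theorem polyComp_self (a : Fin n →₀ ℕ) (x : 𝓝 (ind a.support)) :
    polyComp 𝓝 a (polyIncl 𝓝 a x) = x := by
  rw [polyComp, polyLift_incl, if_pos rfl, Submodule.subtype_apply]

theorem polyComp_ne {a b : Fin n →₀ ℕ} (h : b ≠ a) (x : 𝓝 (ind b.support)) :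
    polyComp 𝓝 a (polyIncl 𝓝 b x) = 0 := by
  rw [polyComp, polyLift_incl, if_neg h, LinearMap.zero_apply]

theorem isInternal_polyModuleGrading : DirectSum.IsInternal (polyModuleGrading 𝓝) := by
  rw [DirectSum.isInternal_submodule_iff_iSupIndep_and_iSup_eq_top]
  constructor
  · rw [iSupIndep_def]
    intro a
    rw [Submodule.disjoint_def]
    rintro _ ⟨x, rfl⟩ hx
    have h : ⨆ b, ⨆ (_ : b ≠ a), polyModuleGrading 𝓝 b ≤ LinearMap.ker (polyComp 𝓝 a) := by
      refine iSup₂_le fun b hb => ?_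
      rintro _ ⟨y, rfl⟩
      exact polyComp_ne hb y
    have h1 : (x : N) = 0 := (polyComp_self a x).symm.trans (h hx)
    rw [Subtype.ext (h1.trans (ZeroMemClass.coe_zero _).symm), map_zero]
  · rw [← Submodule.ker_mkQ (⨆ a, polyModuleGrading 𝓝 a), LinearMap.ker_eq_top]
    refine polyModule_hom_ext 𝓝 fun a x => ?_
    rw [Submodule.mkQ_apply, LinearMap.zero_apply, Submodule.Quotient.mk_eq_zero]
    exact Submodule.mem_iSup_of_mem a ⟨x, rfl⟩

theorem polyIncl_injective (a : Fin n →₀ ℕ) : Function.Injective (polyIncl 𝓝 a) := fun x y h =>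
  Subtype.ext (by rw [← polyComp_self a x, h, polyComp_self])

variable [Module (Ext K n)ᵐᵒᵖ N] [IsScalarTower K (Ext K n)ᵐᵒᵖ N] [IsRightGraded 𝓝]

theorem X_smul_polyIncl (j : Fin n) (a : Fin n →₀ ℕ) (y : 𝓝 (ind a.support)) :
    (X j : MvPolynomial (Fin n) K) • polyIncl 𝓝 a y = polyIncl 𝓝 (a + Finsupp.single j 1)
      ⟨stepMap (K := K) N a.support j y, stepMap_mem 𝓝 a j y y.2⟩ := by
  rw [poly_smul_def, polyHom_X, polyAct_incl]

instance : IsMultigraded (polyModuleGrading 𝓝) where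
  isInternal := isInternal_polyModuleGrading
  X_smul_mem j a := by
    rintro _ ⟨y, rfl⟩
    exact ⟨_, (X_smul_polyIncl j a y).symm⟩

theorem X_smul_bijOn_polyModuleGrading (a : Fin n →₀ ℕ) (j : Fin n) (hj : j ∈ a.support) :
    Set.BijOn (fun m : PolyModule 𝓝 => (X j : MvPolynomial (Fin n) K) • m)
      (polyModuleGrading 𝓝 a) (polyModuleGrading 𝓝 (a + Finsupp.single j 1)) := by
  have hstep : ∀ y : N, stepMap (K := K) N a.support j y = y := fun y => by
    rw [stepMap, if_pos hj, LinearMap.id_apply]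
  refine ⟨fun m hm => IsMultigraded.X_smul_mem j a m hm, ?_, ?_⟩
  · rintro _ ⟨y, rfl⟩ _ ⟨y', rfl⟩ h
    simp only [X_smul_polyIncl] at h
    have h1 := congrArg Subtype.val (polyIncl_injective _ h)
    simp only [hstep] at h1
    rw [Subtype.ext h1]
  · rintro _ ⟨y, rfl⟩
    have hs : (a + Finsupp.single j 1).support = a.support := by
      rw [support_add_single, Finset.insert_eq_of_mem hj]
    have hy : (y : N) ∈ 𝓝 (ind a.support) := hs ▸ y.2
    refine ⟨polyIncl 𝓝 a ⟨y, hy⟩, ⟨_, rfl⟩, ?_⟩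
    simp only [X_smul_polyIncl]
    exact polyIncl_congr 𝓝 rfl (hstep y)

end PolyModule

/-! ### Homogeneous elements of `𝐅(M)` -/

section ExtModule

open MvPolynomial

variable {K : Type u} [Field K] {n : ℕ} {M : Type v} [AddCommGroup M] [Module K M]
  [Module (MvPolynomial (Fin n) K) M]
  (𝓜 : (Fin n →₀ ℕ) → Submodule K M) [IsMultigraded 𝓜]

/-- The projection of `M` onto its part `𝐅(M)` of squarefree degrees. -/
def toExt : M →ₗ[K] ExtModule 𝓜 :=
  LinearMap.pi (φ := fun F : Finset (Fin n) => 𝓜 (ind F)) fun F => proj 𝓜 (ind F)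

theorem extComp_toExt (F : Finset (Fin n)) (v : M) :
    extComp 𝓜 F (toExt 𝓜 v) = proj 𝓜 (ind F) v := rfl

variable {𝓜}

theorem extComp_toExt_self {A : Finset (Fin n)} {v : M} (hv : v ∈ 𝓜 (ind A)) :
    (extComp 𝓜 A (toExt 𝓜 v) : M) = v := by
  rw [extComp_toExt, proj_of_mem hv]

theorem extComp_toExt_ne {A F : Finset (Fin n)} {v : M} (hv : v ∈ 𝓜 (ind A)) (h : A ≠ F) :
    extComp 𝓜 F (toExt 𝓜 v) = 0 := by
  rw [extComp_toExt, proj_of_mem_ne hv fun h' => h (ind_injective h')]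

theorem toExt_mem {A : Finset (Fin n)} {v : M} (hv : v ∈ 𝓜 (ind A)) :
    toExt 𝓜 v ∈ extModuleGrading 𝓜 (ind A) := fun _ hF =>
  extComp_toExt_ne hv fun h => hF (congrArg ind h.symm)

theorem sum_toExt (g : ExtModule 𝓜) : ∑ A, toExt 𝓜 (extComp 𝓜 A g : M) = g := by
  apply extModule_ext
  intro F
  rw [map_sum, Finset.sum_eq_single F]
  · exact extComp_toExt_self (extComp 𝓜 F g).2
  · intro A _ hA
    exact extComp_toExt_ne (extComp 𝓜 A g).2 hA
  · simp

variable [IsScalarTower K (MvPolynomial (Fin n) K) M]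

theorem e_smul_toExt_of_mem {A : Finset (Fin n)} {v : M} (hv : v ∈ 𝓜 (ind A)) {j : Fin n}
    (hj : j ∈ A) : e K j • toExt 𝓜 v = 0 := by
  apply extModule_ext
  intro F
  rw [ext_smul_def, extHom_e, extAct_apply, map_zero]
  split_ifs with h
  · rw [extComp_toExt_ne hv]
    · simp
    · rintro rfl
      simp at hj
  · rfl

theorem e_smul_toExt_of_notMem {A : Finset (Fin n)} {v : M} (hv : v ∈ 𝓜 (ind A)) {j : Fin n}
    (hj : j ∉ A) : e K j • toExt 𝓜 v =
      (-1 : K) ^ below A j • toExt 𝓜 ((X j : MvPolynomial (Fin n) K) • v) := by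
  have hXv : (X j : MvPolynomial (Fin n) K) • v ∈ 𝓜 (ind (insert j A)) := by
    rw [ind_insert hj]
    exact IsMultigraded.X_smul_mem j _ v hv
  have hb : below (insert j A) j = below A j := by
    rw [below, below, Finset.filter_insert, if_neg (lt_irrefl j)]
  apply extModule_ext
  intro F
  rw [ext_smul_def, extHom_e, extAct_apply, map_smul, Submodule.coe_smul]
  by_cases hF : insert j A = F
  · subst hF
    rw [extComp_toExt_self hXv, if_pos (Finset.mem_insert_self j A), Finset.erase_insert hj,
      extComp_toExt_self hv, hb]
    rfl
  · rw [extComp_toExt_ne hXv hF, ZeroMemClass.coe_zero, smul_zero]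
    split_ifs with h
    · rw [extComp_toExt_ne hv]
      · simp
      · rintro rfl
        exact hF (Finset.insert_erase h)
    · rfl

/-! ### Homomorphisms from `𝐅(M)` to the exterior algebra -/

/-- A homomorphism of degree `B` is determined by its top coefficients on `M_{Bᶜ}`, since any
nonzero `y` in a squarefree degree other than `[n]` satisfies `e_j y ≠ 0` for some `j`. -/
theorem eDual_eq_zero {B : Finset (Fin n)} {φ : EDual K n (ExtModule 𝓜)}
    (hφ : φ ∈ eDualGrading (extModuleGrading 𝓜) (ind B))
    (h : ∀ v ∈ 𝓜 (ind Bᶜ), topCoeff K n (φ (toExt 𝓜 v)) = 0) : φ = 0 := by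
  -- By descending induction on `C`, `φ` vanishes on the component of degree `C`.
  have key : ∀ (C : Finset (Fin n)), ∀ v ∈ 𝓜 (ind C), φ (toExt 𝓜 v) = 0 := by
    intro C
    induction hk : Cᶜ.card using Nat.strong_induction_on generalizing C with
    | _ k ih =>
    intro v hv
    have hmem := hφ _ _ (toExt_mem hv)
    by_cases hBC : Disjoint B C
    · rw [← ind_union hBC] at hmem
      by_cases hu : B ∪ C = Finset.univ
      · obtain ⟨c, hc⟩ := exists_eq_smul_eProd hmem
        have hC : Bᶜ = C := (IsCompl.of_eq (Finset.disjoint_iff_inter_eq_empty.mp hBC) hu).compl_eq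
        have h1 := h v (by rwa [hC])
        rw [hc, hu, map_smul, topCoeff_eProd_univ, smul_eq_mul, mul_one] at h1
        rw [hc, h1, zero_smul]
      · obtain ⟨j, hj⟩ : ∃ j, j ∉ B ∪ C := by
          by_contra! h'
          exact hu (Finset.eq_univ_of_forall h')
        have hjC : j ∉ C := fun h' => hj (Finset.mem_union_right B h')
        refine eq_zero_of_e_mul_eq_zero hj hmem ?_
        have hlt : (insert j C)ᶜ.card < k := by
          rw [← hk]
          exact Finset.card_lt_card
            (Finset.compl_ssubset_compl.mpr (Finset.ssubset_insert hjC))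
        have h1 := ih _ hlt (insert j C) rfl ((X j : MvPolynomial (Fin n) K) • v) (by
          rw [ind_insert hjC]
          exact IsMultigraded.X_smul_mem j _ v hv)
        rw [← smul_eq_mul, ← map_smul, e_smul_toExt_of_notMem hv hjC,
          LinearMap.map_smul_of_tower, h1, smul_zero]
    · rwa [extGrading_add_eq_bot hBC, Submodule.mem_bot] at hmem
  ext g
  rw [← sum_toExt g, map_sum]
  exact Finset.sum_eq_zero fun C _ => key C _ (extComp 𝓜 C g).2

/-- The sign in `e_C e_B = ± e_{B ∪ C}` for disjoint `B` and `C`. -/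
def signProd (K : Type u) [Field K] (B C : Finset (Fin n)) : K := ∏ j ∈ C, (-1 : K) ^ below B j

variable (𝓜) in
/-- The homomorphism `𝐅(M) → E` of degree `B` induced by a linear form on `M_{Bᶜ}`. -/
def ofLinearForm (B : Finset (Fin n)) (l : M →ₗ[K] K) : ExtModule 𝓜 →ₗ[K] Ext K n :=
  ∑ C : Finset (Fin n), if Disjoint B C then
    (signProd K B C • l ∘ₗ
      Algebra.lsmul K K M (monomial (ind (Bᶜ \ C)) 1 : MvPolynomial (Fin n) K) ∘ₗ
      (𝓜 (ind C)).subtype ∘ₗ extComp 𝓜 C).smulRight (eProd K (B ∪ C)) else 0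

theorem ofLinearForm_toExt (B : Finset (Fin n)) (l : M →ₗ[K] K) {C : Finset (Fin n)} {v : M}
    (hv : v ∈ 𝓜 (ind C)) : ofLinearForm 𝓜 B l (toExt 𝓜 v) =
      if Disjoint B C then
        (signProd K B C * l ((monomial (ind (Bᶜ \ C)) 1 : MvPolynomial (Fin n) K) • v)) •
          eProd K (B ∪ C) else 0 := by
  rw [ofLinearForm, LinearMap.sum_apply, Finset.sum_eq_single C]
  · split_ifs
    · simp [extComp_toExt_self hv]
    · rfl
  · intro D _ hD
    split_ifs
    · simp [extComp_toExt_ne hv hD.symm]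
    · rfl
  · simp

theorem ofLinearForm_e_smul (B : Finset (Fin n)) (l : M →ₗ[K] K) (j : Fin n)
    (g : ExtModule 𝓜) : ofLinearForm 𝓜 B l (e K j • g) = e K j • ofLinearForm 𝓜 B l g := by
  rw [← sum_toExt g, Finset.smul_sum, map_sum, map_sum, Finset.smul_sum]
  refine Finset.sum_congr rfl fun C _ => ?_
  obtain ⟨v, hv⟩ := extComp 𝓜 C g
  change ofLinearForm 𝓜 B l (e K j • toExt 𝓜 v) = e K j • ofLinearForm 𝓜 B l (toExt 𝓜 v)
  rw [ofLinearForm_toExt B l hv]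
  by_cases hjC : j ∈ C
  · rw [e_smul_toExt_of_mem hv hjC, map_zero]
    split_ifs
    · rw [smul_eq_mul, mul_smul_comm, e_mul_eProd_of_mem K (Finset.mem_union_right B hjC),
        smul_zero]
    · rw [smul_zero]
  have hXv : (X j : MvPolynomial (Fin n) K) • v ∈ 𝓜 (ind (insert j C)) := by
    rw [ind_insert hjC]
    exact IsMultigraded.X_smul_mem j _ v hv
  rw [e_smul_toExt_of_notMem hv hjC, map_smul, ofLinearForm_toExt B l hXv]
  by_cases hBC : Disjoint B C
  · rw [if_pos hBC, smul_eq_mul, mul_smul_comm]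
    by_cases hjB : j ∈ B
    · rw [if_neg fun h => Finset.disjoint_left.mp h hjB (Finset.mem_insert_self j C), smul_zero,
        e_mul_eProd_of_mem K (Finset.mem_union_left C hjB), smul_zero]
    · have h1 : Bᶜ \ C = insert j (Bᶜ \ insert j C) := by
        ext i
        by_cases hi : i = j
        · subst hi; simp [hjB, hjC]
        · simp [hi]
      have h2 : j ∉ Bᶜ \ insert j C := by simp
      have h3 : below (B ∪ C) j = below B j + below C j := by
        rw [below, Finset.filter_union,
          Finset.card_union_of_disjoint (Finset.disjoint_filter_filter hBC)]
        rfl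
      have h4 : signProd K B (insert j C) = (-1) ^ below B j * signProd K B C :=
        Finset.prod_insert hjC
      rw [if_pos (Finset.disjoint_insert_right.mpr ⟨hjB, hBC⟩), h1, ind_insert h2,
        monomial_add_single_smul, smul_comm (X j : MvPolynomial (Fin n) K),
        e_mul_eProd_of_notMem K (by simp [hjB, hjC]), ← Finset.union_insert,
        smul_smul ((-1 : K) ^ below C j), smul_smul (signProd K B C * _), h3, h4, pow_add]
      congr 1
      ring
  · rw [if_neg hBC, if_neg fun h => hBC (Finset.disjoint_insert_right.mp h).2, smul_zero, smul_zero]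

/-- `E` is injective: every linear form on `M_{Bᶜ}` is the top coefficient of a homomorphism of
degree `B`, up to sign. -/
theorem exists_eDual (B : Finset (Fin n)) (l : M →ₗ[K] K) :
    ∃ φ ∈ eDualGrading (extModuleGrading 𝓜) (ind B), ∃ c : K, c ≠ 0 ∧
      ∀ v ∈ 𝓜 (ind Bᶜ), topCoeff K n (φ (toExt 𝓜 v)) = c * l v := by
  refine ⟨{ ofLinearForm 𝓜 B l with
    map_smul' := map_ext_smul (ofLinearForm_e_smul B l) }, ?_, signProd K B Bᶜ, ?_, ?_⟩
  · intro a x hx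
    change ofLinearForm 𝓜 B l x ∈ _
    rw [ofLinearForm, LinearMap.sum_apply]
    refine sum_mem fun C _ => ?_
    by_cases hC : ind C = a
    · subst hC
      split_ifs with h
      · rw [LinearMap.smulRight_apply, ← ind_union h]
        exact Submodule.smul_mem _ _ (eProd_mem _)
      · exact zero_mem _
    · split_ifs
      · rw [LinearMap.smulRight_apply]
        simp [hx C hC]
      · exact zero_mem _
  · exact Finset.prod_ne_zero_iff.mpr fun j _ => pow_ne_zero _ (by simp)
  · intro v hv
    change topCoeff K n (ofLinearForm 𝓜 B l (toExt 𝓜 v)) = _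
    rw [ofLinearForm_toExt B l hv, if_pos disjoint_compl_right, map_smul, Finset.union_compl,
      topCoeff_eProd_univ, sdiff_self]
    simp [ind]

end ExtModule

/-! ### The pairing of a squarefree module with its Alexander dual -/

section Pairing

open MvPolynomial MulOpposite

variable {K : Type u} [Field K] {n : ℕ} {M : Type v} [AddCommGroup M] [Module K M]
  [Module (MvPolynomial (Fin n) K) M] [IsScalarTower K (MvPolynomial (Fin n) K) M]
  (𝓜 : (Fin n →₀ ℕ) → Submodule K M) [IsMultigraded 𝓜]

/-- The homomorphism `𝐅(M) → E` underlying an element of the Alexander dual: the sum of its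
components. -/
def toEDual : AlexanderDual 𝓜 →ₗ[K] EDual K n (ExtModule 𝓜) :=
  polyLift _ fun a => (eDualGrading (extModuleGrading 𝓜) (ind a.support)).subtype

/-- The pairing `⟨v, φ⟩ = [e_1 ⋯ e_n] φ(v)` between `M` and its Alexander dual. -/
def alexanderPairing : M →ₗ[K] AlexanderDual 𝓜 →ₗ[K] K :=
  LinearMap.mk₂ K (fun v w => topCoeff K n (toEDual 𝓜 w (toExt 𝓜 v)))
    (fun v v' w => by simp only [map_add])
    (fun c v w => by simp only [map_smul, LinearMap.map_smul_of_tower])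
    (fun v w w' => by simp only [map_add, LinearMap.add_apply])
    (fun c v w => by simp only [map_smul, LinearMap.smul_apply])

variable {𝓜}

theorem alexanderPairing_polyIncl (v : M) (a : Fin n →₀ ℕ)
    (φ : eDualGrading (extModuleGrading 𝓜) (ind a.support)) :
    alexanderPairing 𝓜 v (polyIncl _ a φ) =
      topCoeff K n ((φ : EDual K n (ExtModule 𝓜)) (toExt 𝓜 v)) := by
  change topCoeff K n (toEDual 𝓜 (polyIncl _ a φ) (toExt 𝓜 v)) = _
  rw [toEDual, polyLift_incl, Submodule.subtype_apply]

variable (𝓜) in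
theorem isComplementPairing_alexanderPairing :
    IsComplementPairing 𝓜 (alexanderDualGrading 𝓜) (alexanderPairing 𝓜) where
  eq_zero_left A v hv hw := by
    by_contra hv0
    -- A linear form not vanishing at `v` is induced by a homomorphism to `E`.
    obtain ⟨l, hl, -⟩ := Submodule.exists_le_ker_of_notMem (p := (⊥ : Submodule K M)) (by simpa)
    obtain ⟨φ, hφ, c, hc, hφl⟩ := exists_eDual (𝓜 := 𝓜) Aᶜ l
    have h1 := hw (polyIncl _ (ind Aᶜ) ⟨φ, by rwa [support_ind]⟩) ⟨_, rfl⟩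
    rw [alexanderPairing_polyIncl] at h1
    have h2 := (hφl v (by rwa [compl_compl])).symm.trans h1
    exact (mul_ne_zero hc hl) h2
  eq_zero_right A := by
    rintro _ ⟨⟨φ, hφ⟩, rfl⟩ hv
    have hφ' := hφ
    rw [support_ind] at hφ'
    have h1 : φ = 0 := eDual_eq_zero hφ' fun v hv' => by
      rw [compl_compl] at hv'
      have := hv v hv'
      rwa [alexanderPairing_polyIncl] at this
    subst h1
    exact map_zero (polyIncl (eDualGrading (extModuleGrading 𝓜)) (ind Aᶜ))
  adjoint A j hj v hv := by
    rintro _ ⟨⟨φ, hφ⟩, rfl⟩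
    rw [X_smul_polyIncl, alexanderPairing_polyIncl, alexanderPairing_polyIncl]
    rw [support_ind] at hφ
    change topCoeff K n (φ (toExt 𝓜 ((X j : MvPolynomial (Fin n) K) • v))) = 0 ↔
      topCoeff K n ((stepMap (K := K) (EDual K n (ExtModule 𝓜)) (ind (insert j A)ᶜ).support j φ)
        (toExt 𝓜 v)) = 0
    rw [support_ind, stepMap, if_neg (by simp)]
    -- Up to sign, both sides are the top coefficient of `e_j * φ v`.
    have hdisj : Disjoint (insert j A)ᶜ A :=
      (disjoint_compl_left (a := insert j A)).mono_right (Finset.subset_insert j A)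
    have hmem := hφ _ _ (toExt_mem hv)
    rw [← ind_union hdisj] at hmem
    obtain ⟨c, hc⟩ := exists_eq_smul_eProd hmem
    have h1 : (-1 : K) ^ below A j • φ (toExt 𝓜 ((X j : MvPolynomial (Fin n) K) • v)) =
        e K j * φ (toExt 𝓜 v) := by
      rw [← LinearMap.map_smul_of_tower, ← e_smul_toExt_of_notMem hv hj, map_smul, smul_eq_mul]
    have h2 : φ (toExt 𝓜 v) * e K j =
        (-1 : K) ^ ((insert j A)ᶜ ∪ A).card • (e K j * φ (toExt 𝓜 v)) := by
      rw [hc, smul_mul_assoc, eProd_mul_e, mul_smul_comm, smul_comm]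
    change _ ↔ topCoeff K n ((-1 : K) ^ above (insert j A)ᶜ j • (φ (toExt 𝓜 v) * e K j)) = 0
    rw [h2, ← h1]
    simp

end Pairing

theorem isSquarefreeModule_alexanderDual {K : Type u} [Field K] {n : ℕ} {M : Type v}
    [AddCommGroup M] [Module K M] [Module (MvPolynomial (Fin n) K) M]
    [IsScalarTower K (MvPolynomial (Fin n) K) M] {𝓜 : (Fin n →₀ ℕ) → Submodule K M}
    [IsSquarefreeModule 𝓜] :
    IsSquarefreeModule (alexanderDualGrading 𝓜) where
  bijOn a i hi := X_smul_bijOn_polyModuleGrading a i hi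
  finite := by
    have : Module.Finite (MvPolynomial (Fin n) K) M := IsSquarefreeModule.finite 𝓜
    exact finite_of_finiteDimensional (alexanderDualGrading 𝓜) X_smul_bijOn_polyModuleGrading
      ((isComplementPairing_alexanderPairing 𝓜).finiteDimensional
        fun A => finiteDimensional_component 𝓜 _)

end

end SqfreeDual

theorem mainTheorem2 {K : Type*} [Field K] {n : ℕ} {M : Type*} [AddCommGroup M] [Module K M]
    [Module (MvPolynomial (Fin n) K) M] [IsScalarTower K (MvPolynomial (Fin n) K) M]
    (𝓜 : (Fin n →₀ ℕ) → Submodule K M) [SqfreeDual.IsSquarefreeModule 𝓜]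
    (r : ℕ) (F G : Fin r → Finset (Fin n)) :
    SqfreeDual.HasPrimeChain 𝓜 F G ↔
      SqfreeDual.HasPrimeChain (SqfreeDual.alexanderDualGrading 𝓜)
        (fun i => G i.rev) (fun i => F i.rev) := by
  have := SqfreeDual.isSquarefreeModule_alexanderDual (𝓜 := 𝓜)
  exact SqfreeDual.hasPrimeChain_iff_of_pairing (SqfreeDual.isComplementPairing_alexanderPairing 𝓜)
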